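/- Let $\mathcal X,\mathcal Y,\mathcal F,\mathcal G$ be finite sets, let $p_{XY}$ be a probability distribution on $\mathcal X\times\mathcal Y$, and let $f:\mathcal X\times\mathcal Y\to\mathcal F$ and $g:\mathcal X\times\mathcal Y\to\mathcal G$ be functions. Let $(X_i,Y_i)$, $i=1,\dots,n$, be i.i.d. with distribution $p_{XY}$; Alice observes $X^n=(X_1,\dots,X_n)$ and Bob observes $Y^n=(Y_1,\dots,Y_n)$. Put $F_i=f(X_i,Y_i)$ and $G_i=g(X_i,Y_i)$. Random variables other than these take values in countable alphabets. The triple $(p_{XY},f,g)$ is called asymptotically securely computable with no interaction if there is a sequence, indexed by $n$, of conditional distributions $p_{M,Z^n|X^nY^n}=p_{M|X^n}\,p_{Z^n|M,Y^n}$ (Alice sends the single message $M$, and Bob outputs $Z^n\in\mathcal F^n$) such that for every $\epsilon>0$ and all sufficiently large $n$, $$P(Z^n\neq F^n)\le\epsilon\qquad\text{and}\qquad I(M;G^n\mid Z^n,Y^n)\le n\epsilon .$$ The triple $(p_{XY},f,g)$ is called perfectly securely computable if, with $(X,Y)\sim p_{XY}$, $F=f(X,Y)$ and $G=g(X,Y)$,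 there is a conditional distribution $p_{U|XY}$ such that $U-X-Y$ is a Markov chain, $H(F\mid U,Y)=0$ and $I(U;G\mid F,Y)=0$. Theorem (equivalence). $(p_{XY},f,g)$ is asymptotically securely computable with no interaction if and only if it is perfectly securely computable. -/

import Mathlib

noncomputable section

namespace SecureComputation

/-- The marginal probability `P(A = a)` of a discrete random variable `A` on a discrete probability
space with law `P`. -/
def prob {Ω α : Type*} (P : PMF Ω) (A : Ω → α) (a : α) : ℝ := ((P.map A) a).toReal

/-- The conditional Shannon entropy
`H(A | B) = ∑_b P(B = b) ∑_a -P(A = a | B = b) log P(A = a | B = b)`, for `A` with finite alphabet.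
Each term is nonnegative and at most `P(B = b) log |α|`, so that the sum over `b` converges. -/
def condEntropy {Ω α β : Type*} [Fintype α] (P : PMF Ω) (A : Ω → α) (B : Ω → β) : ℝ :=
  ∑' b, prob P B b *
    ∑ a, Real.negMulLog (prob P (fun ω => (A ω, B ω)) (a, b) / prob P B b)

/-- The conditional mutual information `I(A ; C | B) = H(C | B) - H(C | A, B)`, for `C` with finite
alphabet (`A` and `B` may have infinite alphabets). -/
def condMutualInfo {Ω α β γ : Type*} [Fintype γ] (P : PMF Ω)
    (A : Ω → α) (C : Ω → γ) (B : Ω → β) : ℝ :=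
  condEntropy P C B - condEntropy P C (fun ω => (A ω, B ω))

/-- The Markov chain `A - B - C`: `P(a, b, c) P(b) = P(a, b) P(b, c)` for all `a`, `b`, `c`. -/
def IsMarkovChain {Ω α β γ : Type*} (P : PMF Ω) (A : Ω → α) (B : Ω → β) (C : Ω → γ) : Prop :=
  ∀ a b c, prob P (fun ω => (A ω, B ω, C ω)) (a, b, c) * prob P B b =
    prob P (fun ω => (A ω, B ω)) (a, b) * prob P (fun ω => (B ω, C ω)) (b, c)

/-- The law of `n` independent copies of a random variable with law `p`. -/
def iid {α : Type*} [Fintype α] (p : PMF α) (n : ℕ) : PMF (Fin n → α) :=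
  PMF.ofFintype (fun w => ∏ i, p (w i)) (by
    classical
    have h : ∑ a, p a = 1 := by rw [← tsum_fintype (L := .unconditional _)]; exact p.tsum_coe
    rw [← Fintype.piFinset_univ, ← Finset.prod_univ_sum (fun _ => Finset.univ) (fun _ a => p a)]
    simp [h])

/-- A protocol of block length `n` with a single transmission, from Alice to Bob: Alice draws a
message from `p_{M | X^n}`, and Bob draws his output from `p_{Z^n | M, Y^n}`. The message takes
values in an arbitrary countable alphabet. -/
structure Protocol (𝒳 𝒴 ℱ : Type*) (n : ℕ) where
  /-- the alphabet of the message -/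
  Msg : Type
  countable_msg : Countable Msg
  /-- `p_{M | X^n}` -/
  alice : (Fin n → 𝒳) → PMF Msg
  /-- `p_{Z^n | M, Y^n}` -/
  bob : Msg → (Fin n → 𝒴) → PMF (Fin n → ℱ)

section

variable {𝒳 𝒴 ℱ 𝒢 : Type*}

/-- The joint law of `((X^n, Y^n), M, Z^n)` for i.i.d. inputs `(X_i, Y_i)` with law `pXY`:
`(∏ i, pXY (x_i, y_i)) * p(m | x^n) * p(z^n | m, y^n)`. -/
def Protocol.law {n : ℕ} [Fintype 𝒳] [Fintype 𝒴] (π : Protocol 𝒳 𝒴 ℱ n) (pXY : PMF (𝒳 × 𝒴)) :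
    PMF ((Fin n → 𝒳 × 𝒴) × π.Msg × (Fin n → ℱ)) :=
  (iid pXY n).bind fun w =>
    (π.alice fun i => (w i).1).bind fun m =>
      (π.bob m fun i => (w i).2).map fun z => (w, m, z)

/-- The probability `P(Z^n ≠ F^n)`, where `F_i = f(X_i, Y_i)`. -/
def Protocol.errorProb {n : ℕ} [Fintype 𝒳] [Fintype 𝒴] (π : Protocol 𝒳 𝒴 ℱ n)
    (pXY : PMF (𝒳 × 𝒴)) (f : 𝒳 → 𝒴 → ℱ) : ℝ :=
  ((π.law pXY).toOuterMeasure {ω | ω.2.2 ≠ fun i => f (ω.1 i).1 (ω.1 i).2}).toReal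

/-- The leakage `I(M ; G^n | Z^n, Y^n)` to Bob, where `G_i = g(X_i, Y_i)`. -/
def Protocol.leakage {n : ℕ} [Fintype 𝒳] [Fintype 𝒴] [Fintype 𝒢] (π : Protocol 𝒳 𝒴 ℱ n)
    (pXY : PMF (𝒳 × 𝒴)) (g : 𝒳 → 𝒴 → 𝒢) : ℝ :=
  condMutualInfo (π.law pXY) (fun ω => ω.2.1) (fun ω i => g (ω.1 i).1 (ω.1 i).2)
    (fun ω => (ω.2.2, fun i => (ω.1 i).2))

/-- `(pXY, f, g)` is asymptotically securely computable with no interaction: some sequence of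
protocols satisfies, for every `ε > 0`, `P(Z^n ≠ F^n) ≤ ε` and `I(M ; G^n | Z^n, Y^n) ≤ n ε` for
all large enough `n`. -/
def AsymptoticallySecurelyComputable [Fintype 𝒳] [Fintype 𝒴] [Fintype 𝒢]
    (pXY : PMF (𝒳 × 𝒴)) (f : 𝒳 → 𝒴 → ℱ) (g : 𝒳 → 𝒴 → 𝒢) : Prop :=
  ∃ π : (n : ℕ) → Protocol 𝒳 𝒴 ℱ n, ∀ ε : ℝ, 0 < ε → ∃ N : ℕ, ∀ n : ℕ, N ≤ n →
    (π n).errorProb pXY f ≤ ε ∧ (π n).leakage pXY g ≤ n * ε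

/-- The joint law of `((X, Y), U)` for inputs with law `pXY` and `U` drawn from `p_{U | XY}`. -/
def auxLaw {𝒰 : Type*} (pXY : PMF (𝒳 × 𝒴)) (pU : 𝒳 → 𝒴 → PMF 𝒰) : PMF ((𝒳 × 𝒴) × 𝒰) :=
  pXY.bind fun w => (pU w.1 w.2).map fun u => (w, u)

/-- `(pXY, f, g)` is perfectly securely computable: for some `p_{U | XY}`, with `U` taking values in
a countable alphabet, `U - X - Y`, `H(F | U, Y) = 0` and `I(U ; G | F, Y) = 0`, where `F = f(X, Y)`
and `G = g(X, Y)`. -/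
def PerfectlySecurelyComputable [Fintype ℱ] [Fintype 𝒢]
    (pXY : PMF (𝒳 × 𝒴)) (f : 𝒳 → 𝒴 → ℱ) (g : 𝒳 → 𝒴 → 𝒢) : Prop :=
  ∃ (𝒰 : Type) (_ : Countable 𝒰) (pU : 𝒳 → 𝒴 → PMF 𝒰),
    IsMarkovChain (auxLaw pXY pU) (fun ω => ω.2) (fun ω => ω.1.1) (fun ω => ω.1.2) ∧
    condEntropy (auxLaw pXY pU) (fun ω => f ω.1.1 ω.1.2) (fun ω => (ω.2, ω.1.2)) = 0 ∧
    condMutualInfo (auxLaw pXY pU) (fun ω => ω.2) (fun ω => g ω.1.1 ω.1.2)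
      (fun ω => (f ω.1.1 ω.1.2, ω.1.2)) = 0

end

end SecureComputation

end

/-!
Write `H(A | B)` also for unnormalised measures on a finite set (`finEntropy`). Then conditioning on
a countable variable is a sum of such entropies over its values, and almost every inequality below
is an instance of Gibbs' inequality `finEntropy_le`: the entropy `H(A | B)` is at most the expected
length `-log Q(A | B)` of any conditional code `Q`, and equality forces `Q` to be the true
conditional law.

*Perfect implies asymptotic.* Alice sends independent copies of `U`, and `H(F | U, Y) = 0` lets Bob
decode `F^n`. By the equality case of Gibbs' inequality, `I(U ; G | F, Y) = 0` means that the
conditional law of `G` given `(F, Y)` is the same for all values of `U`. This passes to products, so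
the protocol leaks nothing.

*Asymptotic implies perfect.* For a protocol of length `n` let `U_i = (M, Y^{≠ i})`. Then
`U_i - X_i - Y_i` is a Markov chain. The entropy `H(F_i | U_i, Y_i)` is small because Bob's output
determines `F_i` up to rare errors and carries no information beyond `(M, Y^n)`. As
`H(G^n | F^n, Y^n)` is additive and `H(G^n | M, Z^n, Y^n)` is at most the sum of the
`H(F_i | M, Y^n) + H(G_i | F_i, M, Y^n)`, the average over `i` of `I(U_i ; G_i | F_i, Y_i)` is at
most the leakage per letter plus an error that tends to zero. Fano's inequality enters only through
codes whose length is linear in the error indicator (`exists_fano_code`).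

It remains to pass to the limit (`exists_finite_decomposition`). An auxiliary variable with
`U - X - Y` is a decomposition of the law of `X` into the laws `q` of `X` given `U = u`, and both
`H(F | U, Y)` and `H(G | U, F, Y)` are the averages of continuous functions of `q`. The triples of
`q` and these two values form a compact set in a finite-dimensional space, so their convex hull is
compact as well. It therefore contains the limit of the averages, and a finite convex combination
that represents this limit is an auxiliary variable with a finite alphabet and no defect.
-/

noncomputable section

namespace SecureComputation

/-! ### Conditional entropy of unnormalised measures on a finite set -/

section Finite

variable {S T α α' β β' γ δ : Type*} [Fintype S] [Fintype T]

open Classical in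
/-- The push-forward under `D` of the measure with density `v` on a finite set: the mass of the
fibre of `D` over `d`. -/
def mass (v : S → ℝ) (D : S → δ) (d : δ) : ℝ := ∑ s, if D s = d then v s else 0

/-- The conditional entropy `H(A | B)` under the measure with density `v` on a finite set. The
measure need not be normalised; for `v ≥ 0` this is homogeneous of degree one in `v`. -/
def finEntropy (v : S → ℝ) (A : S → α) (B : S → β) : ℝ :=
  ∑ s, v s * (Real.log (mass v B (B s)) - Real.log (mass v (fun s => (A s, B s)) (A s, B s)))

/-- The conditional probability `P(A = a | B = b)` under the measure with density `v`; it is `0`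
when `B = b` has no mass. -/
def condProb (v : S → ℝ) (A : S → α) (B : S → β) (a : α) (b : β) : ℝ :=
  mass v (fun s => (A s, B s)) (a, b) / mass v B b

lemma mass_nonneg {v : S → ℝ} (hv : ∀ s, 0 ≤ v s) (D : S → δ) (d : δ) : 0 ≤ mass v D d := by
  classical
  exact Finset.sum_nonneg fun s _ => by split_ifs <;> simp [hv]

lemma le_mass {v : S → ℝ} (hv : ∀ s, 0 ≤ v s) (D : S → δ) (s : S) : v s ≤ mass v D (D s) := by
  classical
  have h := Finset.single_le_sum (f := fun t => if D t = D s then v t else 0)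
    (fun t _ => by split_ifs <;> simp [hv]) (Finset.mem_univ s)
  simpa [mass] using h

lemma mass_pos {v : S → ℝ} (hv : ∀ s, 0 ≤ v s) (D : S → δ) {s : S} (hs : v s ≠ 0) :
    0 < mass v D (D s) :=
  ((hv s).lt_of_ne' hs).trans_le (le_mass hv D s)

lemma mass_le_of_imp {v : S → ℝ} (hv : ∀ s, 0 ≤ v s) {D : S → δ} {D' : S → γ} {d : δ} {d' : γ}
    (h : ∀ s, D s = d → D' s = d') : mass v D d ≤ mass v D' d' := by
  classical
  refine Finset.sum_le_sum fun s _ => ?_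
  by_cases h1 : D s = d
  · simp [h1, h s h1]
  · simp only [h1, if_false]
    split_ifs <;> simp [hv]

lemma mass_congr {v : S → ℝ} {D : S → δ} {D' : S → γ} {d : δ} {d' : γ}
    (h : ∀ s, v s ≠ 0 → (D s = d ↔ D' s = d')) : mass v D d = mass v D' d' := by
  classical
  refine Finset.sum_congr rfl fun s _ => ?_
  by_cases h0 : v s = 0
  · simp [h0]
  · simp [h s h0]

lemma sum_mul_comp [Fintype δ] (v : S → ℝ) (D : S → δ) (h : δ → ℝ) :
    ∑ s, v s * h (D s) = ∑ d, mass v D d * h d := by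
  classical
  simp only [mass, Finset.sum_mul]
  rw [Finset.sum_comm]
  refine Finset.sum_congr rfl fun s _ => ?_
  simp

lemma sum_mass [Fintype δ] (v : S → ℝ) (D : S → δ) : ∑ d, mass v D d = ∑ s, v s := by
  simpa using (sum_mul_comp v D fun _ => 1).symm

lemma mass_mass (v : S → ℝ) (f : S → T) (D : T → δ) (d : δ) :
    mass (mass v f) D d = mass v (fun s => D (f s)) d := by
  classical
  have h := sum_mul_comp v f fun t => if D t = d then 1 else 0
  simp only [mul_ite, mul_one, mul_zero] at h
  exact h.symm

lemma sum_mass_pair [Fintype α] (v : S → ℝ) (A : S → α) (B : S → β) (b : β) :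
    ∑ a, mass v (fun s => (A s, B s)) (a, b) = mass v B b := by
  classical
  simp only [mass]
  rw [Finset.sum_comm]
  refine Finset.sum_congr rfl fun s _ => ?_
  by_cases h : B s = b <;> simp [h]

lemma finEntropy_mass (v : S → ℝ) (f : S → T) (A : T → α) (B : T → β) :
    finEntropy (mass v f) A B = finEntropy v (fun s => A (f s)) (fun s => B (f s)) := by
  unfold finEntropy
  simp only [mass_mass]
  exact (sum_mul_comp v f fun t => Real.log (mass v (fun s => B (f s)) (B t)) -
    Real.log (mass v (fun s => (A (f s), B (f s))) (A t, B t))).symm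

lemma condProb_nonneg {v : S → ℝ} (hv : ∀ s, 0 ≤ v s) (A : S → α) (B : S → β) (a : α) (b : β) :
    0 ≤ condProb v A B a b :=
  div_nonneg (mass_nonneg hv _ _) (mass_nonneg hv _ _)

lemma sum_condProb_le_one [Fintype α] (v : S → ℝ) (A : S → α) (B : S → β) (b : β) :
    ∑ a, condProb v A B a b ≤ 1 := by
  simp only [condProb]
  rw [← Finset.sum_div, sum_mass_pair]
  exact div_self_le_one _

lemma condProb_pos {v : S → ℝ} (hv : ∀ s, 0 ≤ v s) (A : S → α) (B : S → β) {s : S}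
    (hs : v s ≠ 0) : 0 < condProb v A B (A s) (B s) :=
  div_pos (mass_pos hv (fun s => (A s, B s)) hs) (mass_pos hv B hs)

lemma condProb_le_one {v : S → ℝ} (hv : ∀ s, 0 ≤ v s) (A : S → α) (B : S → β) (a : α) (b : β) :
    condProb v A B a b ≤ 1 :=
  div_le_one_of_le₀ (mass_le_of_imp hv fun _ h => (Prod.ext_iff.1 h).2) (mass_nonneg hv _ _)

lemma finEntropy_eq {v : S → ℝ} (hv : ∀ s, 0 ≤ v s) (A : S → α) (B : S → β) :
    finEntropy v A B = ∑ s, v s * -Real.log (condProb v A B (A s) (B s)) := by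
  refine Finset.sum_congr rfl fun s _ => ?_
  by_cases hs : v s = 0
  · simp [hs]
  · rw [condProb, Real.log_div (mass_pos hv (fun s => (A s, B s)) hs).ne' (mass_pos hv B hs).ne',
      neg_sub]

lemma finEntropy_nonneg {v : S → ℝ} (hv : ∀ s, 0 ≤ v s) (A : S → α) (B : S → β) :
    0 ≤ finEntropy v A B := by
  rw [finEntropy_eq hv]
  exact Finset.sum_nonneg fun s _ => mul_nonneg (hv s) (neg_nonneg.2 (Real.log_nonpos
    (condProb_nonneg hv _ _ _ _) (condProb_le_one hv _ _ _ _)))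

/-- The conditional entropy depends only on the partitions that the two variables generate on the
support of `v`. -/
lemma finEntropy_congr {v : S → ℝ} {A : S → α} {A' : S → α'} {B : S → β} {B' : S → β'}
    (hA : ∀ s t, v s ≠ 0 → v t ≠ 0 → (A s = A t ↔ A' s = A' t))
    (hB : ∀ s t, v s ≠ 0 → v t ≠ 0 → (B s = B t ↔ B' s = B' t)) :
    finEntropy v A B = finEntropy v A' B' := by
  refine Finset.sum_congr rfl fun t _ => ?_
  by_cases ht : v t = 0
  · simp [ht]
  rw [mass_congr (D := B) (D' := B') (d' := B' t) fun s hs => hB s t hs ht,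
    mass_congr (D := fun s => (A s, B s)) (D' := fun s => (A' s, B' s)) (d' := (A' t, B' t))
      fun s hs => by simp [hA s t hs ht, hB s t hs ht]]

section Gibbs

lemma mul_neg_log_sub {v : S → ℝ} {A : S → α} {B : S → β} {Q : α → β → ℝ}
    (hv : ∀ s, 0 ≤ v s) (hpos : ∀ s, v s ≠ 0 → 0 < Q (A s) (B s)) (s : S) :
    v s * -Real.log (Q (A s) (B s)) - v s * (Real.log (mass v B (B s)) -
        Real.log (mass v (fun s => (A s, B s)) (A s, B s))) =
      v s * -Real.log (Q (A s) (B s) * mass v B (B s) /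
        mass v (fun s => (A s, B s)) (A s, B s)) := by
  by_cases hs : v s = 0
  · simp [hs]
  · have h1 := mass_pos hv B hs
    have h2 := mass_pos hv (fun s => (A s, B s)) hs
    have h3 := hpos s hs
    rw [Real.log_div (by positivity) (by positivity), Real.log_mul (by positivity) (by positivity)]
    ring

variable [Fintype α] [Fintype β] {v : S → ℝ} {A : S → α} {B : S → β} {Q : α → β → ℝ}

lemma sum_mul_ratio_le (hv : ∀ s, 0 ≤ v s) (hQ : ∀ a b, 0 ≤ Q a b) (hQ1 : ∀ b, ∑ a, Q a b ≤ 1) :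
    ∑ s, v s * (Q (A s) (B s) * mass v B (B s) / mass v (fun s => (A s, B s)) (A s, B s)) ≤
      ∑ s, v s := by
  calc _ = ∑ c : α × β, mass v (fun s => (A s, B s)) c *
        (Q c.1 c.2 * mass v B c.2 / mass v (fun s => (A s, B s)) c) :=
      sum_mul_comp v (fun s => (A s, B s))
        fun c => Q c.1 c.2 * mass v B c.2 / mass v (fun s => (A s, B s)) c
    _ ≤ ∑ c : α × β, Q c.1 c.2 * mass v B c.2 := by
      refine Finset.sum_le_sum fun c _ => ?_
      rcases (mass_nonneg hv (fun s => (A s, B s)) c).eq_or_lt with h | h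
      · rw [← h]; simpa using mul_nonneg (hQ _ _) (mass_nonneg hv _ _)
      · rw [mul_div_cancel₀ _ h.ne']
    _ = ∑ b, (∑ a, Q a b) * mass v B b := by
      rw [Fintype.sum_prod_type_right]
      simp only [Finset.sum_mul]
    _ ≤ ∑ b, mass v B b := Finset.sum_le_sum fun b _ =>
      mul_le_of_le_one_left (mass_nonneg hv _ _) (hQ1 b)
    _ = ∑ s, v s := sum_mass v B

/-- **Gibbs' inequality**: coding `A` with a conditional sub-probability `Q` instead of the true
conditional law costs at least `H(A | B)`. -/
theorem finEntropy_le (hv : ∀ s, 0 ≤ v s) (hQ : ∀ a b, 0 ≤ Q a b) (hQ1 : ∀ b, ∑ a, Q a b ≤ 1)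
    (hpos : ∀ s, v s ≠ 0 → 0 < Q (A s) (B s)) :
    finEntropy v A B ≤ ∑ s, v s * -Real.log (Q (A s) (B s)) := by
  rw [← sub_nonneg, finEntropy, ← Finset.sum_sub_distrib,
    Finset.sum_congr rfl fun s _ => mul_neg_log_sub hv hpos s]
  have h := sum_mul_ratio_le (A := A) (B := B) hv hQ hQ1
  have h2 : ∑ s, (v s - v s * (Q (A s) (B s) * mass v B (B s) /
      mass v (fun s => (A s, B s)) (A s, B s))) ≤ ∑ s, v s * -Real.log (Q (A s) (B s) *
      mass v B (B s) / mass v (fun s => (A s, B s)) (A s, B s)) := by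
    refine Finset.sum_le_sum fun s _ => ?_
    by_cases hs : v s = 0
    · simp [hs]
    · have h1 := mass_pos hv B hs
      have h2 := mass_pos hv (fun s => (A s, B s)) hs
      have h3 := hpos s hs
      nlinarith [Real.log_le_sub_one_of_pos (show 0 < Q (A s) (B s) * mass v B (B s) /
        mass v (fun s => (A s, B s)) (A s, B s) by positivity), hv s]
  rw [Finset.sum_sub_distrib] at h2
  linarith

/-- The equality case of Gibbs' inequality: `Q` is the true conditional law wherever `v` has
mass. -/
theorem mass_eq_of_finEntropy_eq (hv : ∀ s, 0 ≤ v s) (hQ : ∀ a b, 0 ≤ Q a b)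
    (hQ1 : ∀ b, ∑ a, Q a b ≤ 1) (hpos : ∀ s, v s ≠ 0 → 0 < Q (A s) (B s))
    (heq : finEntropy v A B = ∑ s, v s * -Real.log (Q (A s) (B s))) {s : S} (hs : v s ≠ 0) :
    mass v (fun s => (A s, B s)) (A s, B s) = Q (A s) (B s) * mass v B (B s) := by
  set t : S → ℝ := fun s => Q (A s) (B s) * mass v B (B s) /
        mass v (fun s => (A s, B s)) (A s, B s) with ht
  have h := sum_mul_ratio_le (A := A) (B := B) hv hQ hQ1
  have htpos : ∀ s, v s ≠ 0 → 0 < t s := fun s hs => by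
    have h1 := mass_pos hv B hs
    have h2 := mass_pos hv (fun s => (A s, B s)) hs
    have h3 := hpos s hs
    positivity
  have h0 : ∑ s, v s * -Real.log (t s) = 0 := by
    rw [← sub_eq_zero.2 heq.symm, finEntropy, ← Finset.sum_sub_distrib]
    exact Finset.sum_congr rfl fun s _ => (mul_neg_log_sub hv hpos s).symm
  have hterm : ∀ s, 0 ≤ v s * (t s - 1 - Real.log (t s)) := fun s => by
    by_cases hs : v s = 0
    · simp [hs]
    · exact mul_nonneg (hv s) (by linarith [Real.log_le_sub_one_of_pos (htpos s hs)])
  have hsum : ∑ s, v s * (t s - 1 - Real.log (t s)) ≤ 0 := by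
    have : ∑ s, v s * (t s - 1 - Real.log (t s)) =
        ∑ s, v s * t s - ∑ s, v s + ∑ s, v s * -Real.log (t s) := by
      rw [← Finset.sum_sub_distrib, ← Finset.sum_add_distrib]
      exact Finset.sum_congr rfl fun s _ => by ring
    rw [this, h0]
    linarith
  have hz := (Finset.sum_eq_zero_iff_of_nonneg fun s _ => hterm s).1
    (le_antisymm hsum (Finset.sum_nonneg fun s _ => hterm s)) s (Finset.mem_univ s)
  have h1 : t s = 1 := by
    by_contra hne
    have := Real.log_lt_sub_one_of_pos (htpos s hs) hne
    rcases mul_eq_zero.1 hz with h | h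
    · exact hs h
    · linarith
  exact ((div_eq_one_iff_eq (mass_pos hv (fun s => (A s, B s)) hs).ne').1 h1).symm

end Gibbs

/-- Conditioning on more reduces entropy. -/
lemma finEntropy_anti_right [Fintype α] [Fintype β] {v : S → ℝ} (hv : ∀ s, 0 ≤ v s) (A : S → α)
    (B : S → β) (φ : β → γ) : finEntropy v A B ≤ finEntropy v A (fun s => φ (B s)) := by
  rw [finEntropy_eq hv A (fun s => φ (B s))]
  exact finEntropy_le (Q := fun a b => condProb v A (fun s => φ (B s)) a (φ b)) hv
    (fun _ _ => condProb_nonneg hv _ _ _ _) (fun _ => sum_condProb_le_one _ _ _ _)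
    fun s hs => condProb_pos hv A (fun s => φ (B s)) hs

/-- A function of `A` has less entropy than `A`. -/
lemma finEntropy_mono_left {v : S → ℝ} (hv : ∀ s, 0 ≤ v s) (A : S → α)
    (B : S → β) (φ : α → γ) : finEntropy v (fun s => φ (A s)) B ≤ finEntropy v A B := by
  refine Finset.sum_le_sum fun s _ => ?_
  by_cases hs : v s = 0
  · simp [hs]
  · refine mul_le_mul_of_nonneg_left (sub_le_sub_left (Real.log_le_log
      (mass_pos hv (fun s => (A s, B s)) hs) (mass_le_of_imp hv fun t ht => ?_)) _) (hv s)
    simp only [Prod.mk.injEq] at ht ⊢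
    exact ⟨congrArg φ ht.1, ht.2⟩

lemma mass_smul (c : ℝ) (v : S → ℝ) (D : S → δ) (d : δ) :
    mass (fun s => c * v s) D d = c * mass v D d := by
  classical
  simp only [mass, Finset.mul_sum]
  exact Finset.sum_congr rfl fun s _ => by split_ifs <;> simp

lemma finEntropy_smul {v : S → ℝ} (hv : ∀ s, 0 ≤ v s) (c : ℝ) (A : S → α) (B : S → β) :
    finEntropy (fun s => c * v s) A B = c * finEntropy v A B := by
  rcases eq_or_ne c 0 with rfl | hc
  · simp [finEntropy]
  · simp only [finEntropy, mass_smul, Finset.mul_sum]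
    refine Finset.sum_congr rfl fun s _ => ?_
    by_cases hs : v s = 0
    · simp [hs]
    · rw [Real.log_mul hc (mass_pos hv B hs).ne',
        Real.log_mul hc (mass_pos hv (fun s => (A s, B s)) hs).ne']
      ring

lemma finEntropy_eq_sum_negMulLog [Fintype α] [Fintype β] (v : S → ℝ) (A : S → α) (B : S → β) :
    finEntropy v A B = ∑ c : α × β, Real.negMulLog (mass v (fun s => (A s, B s)) c) -
      ∑ b, Real.negMulLog (mass v B b) := by
  have h1 := sum_mul_comp v B fun b => Real.log (mass v B b)
  have h2 := sum_mul_comp v (fun s => (A s, B s))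
    fun c => Real.log (mass v (fun s => (A s, B s)) c)
  simp only [finEntropy, mul_sub, Finset.sum_sub_distrib, Real.negMulLog, neg_mul,
    Finset.sum_neg_distrib, h1, h2]
  ring

lemma continuous_mass {X : Type*} [TopologicalSpace X] {v : X → S → ℝ} (hv : Continuous v)
    (D : S → δ) (d : δ) : Continuous fun x => mass (v x) D d := by
  classical
  refine continuous_finsetSum _ fun s _ => ?_
  split_ifs
  · exact (continuous_apply s).comp hv
  · exact continuous_const

lemma continuous_finEntropy [Fintype α] [Fintype β] {X : Type*} [TopologicalSpace X]
    {v : X → S → ℝ} (hv : Continuous v) (A : S → α) (B : S → β) :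
    Continuous fun x => finEntropy (v x) A B := by
  simp only [finEntropy_eq_sum_negMulLog]
  exact (continuous_finsetSum _ fun c _ =>
      Real.continuous_negMulLog.comp (continuous_mass hv (fun s => (A s, B s)) c)).sub
    (continuous_finsetSum _ fun b _ => Real.continuous_negMulLog.comp (continuous_mass hv B b))

/-- The textbook formula for the conditional entropy. -/
lemma sum_mass_mul_negMulLog [Fintype α] [Fintype β] {v : S → ℝ} (hv : ∀ s, 0 ≤ v s) (A : S → α)
    (B : S → β) :
    ∑ b, mass v B b * ∑ a, Real.negMulLog (mass v (fun s => (A s, B s)) (a, b) / mass v B b) =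
      finEntropy v A B := by
  have h := sum_mul_comp v (fun s => (A s, B s)) fun c =>
    Real.log (mass v B c.2) - Real.log (mass v (fun s => (A s, B s)) c)
  rw [finEntropy, h, Fintype.sum_prod_type_right]
  refine Finset.sum_congr rfl fun b _ => ?_
  rw [Finset.mul_sum]
  refine Finset.sum_congr rfl fun a _ => ?_
  have hle : mass v (fun s => (A s, B s)) (a, b) ≤ mass v B b :=
    mass_le_of_imp hv fun _ h => (Prod.ext_iff.1 h).2
  rcases (mass_nonneg hv (fun s => (A s, B s)) (a, b)).eq_or_lt with h | h
  · simp [← h]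
  · have hb := h.trans_le hle
    rw [Real.negMulLog, Real.log_div h.ne' hb.ne']
    field_simp
    ring

lemma mass_slice (v : S → ℝ) (f : S → T) (C : S → γ) (D : T → δ) (d : δ) (c : γ) :
    mass (fun t => mass v (fun s => (f s, C s)) (t, c)) D d =
      mass v (fun s => (D (f s), C s)) (d, c) := by
  classical
  have h := sum_mul_comp (fun s => if C s = c then v s else 0) f fun t => if D t = d then 1 else 0
  have hm : ∀ t, mass v (fun s => (f s, C s)) (t, c) =
      mass (fun s => if C s = c then v s else 0) f t := fun t => by
    refine Finset.sum_congr rfl fun s _ => ?_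
    by_cases h1 : f s = t <;> simp [h1]
  simp only [mul_ite, mul_one, mul_zero] at h
  rw [mass, Finset.sum_congr rfl fun t _ => by rw [hm t], ← h]
  refine Finset.sum_congr rfl fun s _ => ?_
  by_cases h1 : D (f s) = d <;> simp [h1]

/-- Conditioning also on `C` means summing over the slices `C = c`. -/
lemma finEntropy_prod_right [Fintype γ] (v : S → ℝ) (f : S → T) (C : S → γ) (A : T → α)
    (B : T → β) :
    finEntropy v (fun s => A (f s)) (fun s => (B (f s), C s)) =
      ∑ c, finEntropy (fun t => mass v (fun s => (f s, C s)) (t, c)) A B := by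
  have h := sum_mul_comp v (fun s => (f s, C s)) fun p : T × γ =>
    Real.log (mass v (fun s => (B (f s), C s)) (B p.1, p.2)) -
      Real.log (mass v (fun s => ((A (f s), B (f s)), C s)) ((A p.1, B p.1), p.2))
  have hs : ∀ t c, mass (fun t => mass v (fun s => (f s, C s)) (t, c)) (fun s => (A s, B s))
      (A t, B t) = mass v (fun s => ((A (f s), B (f s)), C s)) ((A t, B t), c) := fun t c =>
    mass_slice v f C (fun s => (A s, B s)) (A t, B t) c
  simp only [finEntropy, hs, mass_slice]
  rw [Fintype.sum_prod_type_right] at h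
  refine Eq.trans ?_ h
  refine Finset.sum_congr rfl fun s _ => ?_
  rw [mass_congr (D := fun s => (A (f s), B (f s), C s))
    (D' := fun s => ((A (f s), B (f s)), C s)) (d' := ((A (f s), B (f s)), C s))]
  intro t _
  simp [and_assoc]

end Finite

/-! ### Discrete random variables with a countable component -/

section Discrete

variable {Ω S α β δ ε μ : Type*}

lemma prob_nonneg (P : PMF Ω) (A : Ω → α) (a : α) : 0 ≤ prob P A a := ENNReal.toReal_nonneg

lemma hasSum_prob (P : PMF Ω) (M : Ω → μ) (W : Ω → S) (s : S) :
    HasSum (fun m => prob P (fun ω => (M ω, W ω)) (m, s)) (prob P W s) := by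
  classical
  have h : (P.map W) s = ∑' m, (P.map fun ω => (M ω, W ω)) (m, s) := by
    simp only [PMF.map_apply]
    rw [ENNReal.tsum_comm]
    refine tsum_congr fun ω => ?_
    by_cases h : s = W ω <;> simp [h]
  have hne : ∑' m, (P.map fun ω => (M ω, W ω)) (m, s) ≠ ⊤ := h ▸ PMF.apply_ne_top _ _
  rw [prob, h, ENNReal.tsum_toReal_eq (ENNReal.ne_top_of_tsum_ne_top hne)]
  exact ENNReal.hasSum_toReal hne

variable [Fintype S]

lemma prob_eq_mass_slice (P : PMF Ω) (M : Ω → μ) (W : Ω → S) {E : Ω → ε} {e : ε} {m : μ}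
    {D : S → δ} {d : δ} (h : ∀ ω, E ω = e ↔ M ω = m ∧ D (W ω) = d) :
    prob P E e = mass (fun s => prob P (fun ω => (M ω, W ω)) (m, s)) D d := by
  classical
  have h1 : (P.map E) e = ∑ s, if D s = d then (P.map fun ω => (M ω, W ω)) (m, s) else 0 := by
    have hs : ∀ s, (if D s = d then (P.map fun ω => (M ω, W ω)) (m, s) else 0) =
        ∑' ω, if D s = d ∧ M ω = m ∧ W ω = s then P ω else 0 := fun s => by
      by_cases hd : D s = d
      · rw [if_pos hd, PMF.map_apply]
        refine tsum_congr fun ω => ?_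
        simp only [hd, Prod.mk.injEq, true_and, eq_comm]
      · simp [hd]
    rw [Finset.sum_congr rfl fun s _ => hs s, PMF.map_apply,
      ← Summable.tsum_finsetSum fun _ _ => ENNReal.summable]
    refine tsum_congr fun ω => ?_
    rw [Finset.sum_eq_single (W ω) (fun s _ hs => by simp [hs.symm]) (by simp)]
    simp only [eq_comm (a := e), h ω, true_and, and_comm]
  rw [prob, h1, ENNReal.toReal_sum fun s _ => by
    split_ifs
    exacts [PMF.apply_ne_top _ _, ENNReal.zero_ne_top]]
  refine Finset.sum_congr rfl fun s _ => ?_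
  split_ifs <;> simp [prob]

lemma prob_comp (P : PMF Ω) (W : Ω → S) (D : S → δ) (d : δ) :
    prob P (fun ω => D (W ω)) d = mass (prob P W) D d := by
  classical
  rw [prob_eq_mass_slice P (fun _ => ()) W (m := ()) (D := D) (d := d) (by simp)]
  congr 1
  funext s
  simp [prob, PMF.map_apply]

lemma sum_toReal_pmf (P : PMF S) : ∑ s, (P s).toReal = 1 := by
  rw [← ENNReal.toReal_sum fun s _ => PMF.apply_ne_top _ _, ← tsum_fintype (L := .unconditional _),
    PMF.tsum_coe, ENNReal.toReal_one]

lemma sum_prob (P : PMF Ω) (W : Ω → S) : ∑ s, prob P W s = 1 := sum_toReal_pmf (P.map W)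

lemma hasSum_sum_prob_mul (P : PMF Ω) (M : Ω → μ) (W : Ω → S) (h : S → ℝ) :
    HasSum (fun m => ∑ s, prob P (fun ω => (M ω, W ω)) (m, s) * h s) (∑ s, prob P W s * h s) :=
  hasSum_sum fun s _ => (hasSum_prob P M W s).mul_right (h s)

lemma condEntropy_comp [Fintype α] [Fintype β] (P : PMF Ω) (W : Ω → S) (A : S → α) (B : S → β) :
    condEntropy P (fun ω => A (W ω)) (fun ω => B (W ω)) = finEntropy (prob P W) A B := by
  rw [condEntropy, tsum_fintype, ← sum_mass_mul_negMulLog (prob_nonneg P W)]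
  simp only [prob_comp P W B, prob_comp P W fun s => (A s, B s)]

lemma finEntropy_le_log_card [Fintype α] [Fintype β] {v : S → ℝ} (hv : ∀ s, 0 ≤ v s) (A : S → α)
    (B : S → β) : finEntropy v A B ≤ ∑ s, v s * Real.log (Fintype.card α) := by
  rcases isEmpty_or_nonempty α with h | h
  · have : IsEmpty S := ⟨fun s => h.elim (A s)⟩
    simp [finEntropy]
  · refine (finEntropy_le (Q := fun _ _ => (Fintype.card α : ℝ)⁻¹) hv (fun _ _ => by positivity)
      (fun _ => ?_) fun _ _ => by positivity).trans_eq (by simp)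
    simp

/-- Conditional entropies of finite variables sum over the values of a countable variable. -/
lemma hasSum_finEntropy_slice [Fintype α] [Fintype β] (P : PMF Ω) (M : Ω → μ) (W : Ω → S)
    (A : S → α) (B : S → β) :
    HasSum (fun m => finEntropy (fun s => prob P (fun ω => (M ω, W ω)) (m, s)) A B)
      (condEntropy P (fun ω => A (W ω)) fun ω => (M ω, B (W ω))) := by
  have hv : ∀ m s, 0 ≤ prob P (fun ω => (M ω, W ω)) (m, s) := fun m s => prob_nonneg _ _ _
  have hsum : Summable fun m => finEntropy (fun s => prob P (fun ω => (M ω, W ω)) (m, s)) A B :=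
    Summable.of_nonneg_of_le (fun m => finEntropy_nonneg (hv m) A B)
      (fun m => finEntropy_le_log_card (hv m) A B)
      (hasSum_sum_prob_mul P M W fun _ => Real.log (Fintype.card α)).summable
  have hB : ∀ m b, prob P (fun ω => (M ω, B (W ω))) (m, b) =
      mass (fun s => prob P (fun ω => (M ω, W ω)) (m, s)) B b := fun m b =>
    prob_eq_mass_slice P M W fun ω => by simp
  have hAB : ∀ m a b, prob P (fun ω => (A (W ω), M ω, B (W ω))) (a, m, b) =
      mass (fun s => prob P (fun ω => (M ω, W ω)) (m, s)) (fun s => (A s, B s)) (a, b) :=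
    fun m a b => prob_eq_mass_slice P M W fun ω => by simp; tauto
  set f : μ × β → ℝ := fun c => prob P (fun ω => (M ω, B (W ω))) c *
    ∑ a, Real.negMulLog (prob P (fun ω => (A (W ω), M ω, B (W ω))) (a, c) /
      prob P (fun ω => (M ω, B (W ω))) c) with hf
  have hfm : ∀ m, ∑' b, f (m, b) =
      finEntropy (fun s => prob P (fun ω => (M ω, W ω)) (m, s)) A B := fun m => by
    rw [tsum_fintype, ← sum_mass_mul_negMulLog (hv m)]
    simp only [hf, hB, hAB]
  have hf0 : 0 ≤ f := fun c => by
    obtain ⟨m, b⟩ := c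
    simp only [hf, hB, hAB, Pi.zero_apply]
    refine mul_nonneg (mass_nonneg (hv m) _ _) (Finset.sum_nonneg fun a _ => ?_)
    exact Real.negMulLog_nonneg (condProb_nonneg (hv m) A B a b) (condProb_le_one (hv m) A B a b)
  have hfs : Summable f := (summable_prod_of_nonneg hf0).2
    ⟨fun m => Summable.of_finite, by simpa only [hfm] using hsum⟩
  have : condEntropy P (fun ω => A (W ω)) (fun ω => (M ω, B (W ω))) = ∑' c, f c := rfl
  rw [this, hfs.tsum_prod]
  simp only [hfm]
  exact hsum.hasSum

lemma hasSum_condMutualInfo [Fintype α] [Fintype β] (P : PMF Ω) (M : Ω → μ) (W : Ω → S)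
    (A : S → α) (B : S → β) :
    HasSum (fun m => finEntropy (fun s => prob P (fun ω => (M ω, W ω)) (m, s)) A B)
      (finEntropy (prob P W) A B -
        condMutualInfo P M (fun ω => A (W ω)) fun ω => B (W ω)) := by
  rw [condMutualInfo, condEntropy_comp, sub_sub_cancel]
  exact hasSum_finEntropy_slice P M W A B

lemma prob_of_injective (P : PMF Ω) {E : Ω → ε} (hE : Function.Injective E) (ω : Ω) :
    prob P E (E ω) = (P ω).toReal := by
  classical
  simp only [prob, PMF.map_apply, hE.eq_iff]
  simp

lemma toReal_toOuterMeasure_comp (P : PMF Ω) (W : Ω → S) (C : S → Prop) [DecidablePred C] :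
    (P.toOuterMeasure {ω | C (W ω)}).toReal = ∑ s, prob P W s * if C s then 1 else 0 := by
  have : {ω | C (W ω)} = W ⁻¹' {s | C s} := rfl
  rw [this, ← PMF.toOuterMeasure_map_apply, PMF.toOuterMeasure_apply_fintype,
    ENNReal.toReal_sum fun s _ => by
      by_cases h : C s
      · simpa [Set.indicator, h] using PMF.apply_ne_top (P.map W) s
      · simp [Set.indicator, h]]
  refine Finset.sum_congr rfl fun s _ => ?_
  by_cases h : C s <;> simp [Set.indicator, h, prob]

end Discrete

/-! ### Convex hulls of compact sets -/

section Convex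

variable {E : Type*} [NormedAddCommGroup E] [NormedSpace ℝ E]

/-- By Carathéodory's theorem the hull of `K` is the image of a compact set: the convex
combinations of `dim E + 1` points of `K`. -/
theorem isCompact_convexHull [FiniteDimensional ℝ E] {K : Set E} (hK : IsCompact K) :
    IsCompact (convexHull ℝ K) := by
  classical
  rcases K.eq_empty_or_nonempty with rfl | ⟨z₀, hz₀⟩
  · simp
  set N := Module.finrank ℝ E + 1 with hN
  set Φ : (Fin N → ℝ) × (Fin N → E) → E := fun c => ∑ i, c.1 i • c.2 i with hΦ
  have hΦc : Continuous Φ := by fun_prop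
  have himg : Φ '' (stdSimplex ℝ (Fin N) ×ˢ Set.univ.pi fun _ => K) = convexHull ℝ K := by
    apply Set.Subset.antisymm
    · rintro _ ⟨⟨w, z⟩, ⟨hw, hz⟩, rfl⟩
      exact mem_convexHull_of_exists_fintype w z hw.1 hw.2 (fun i => hz i trivial) rfl
    · intro x hx
      obtain ⟨ι, _, z, w, hz, hai, hw, hw1, hx⟩ := eq_pos_convex_span_of_mem_convexHull hx
      have hcard : Fintype.card ι ≤ Fintype.card (Fin N) := by
        simpa using (hai.card_le_finrank_succ).trans
          (Nat.succ_le_succ (Submodule.finrank_le _))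
      obtain ⟨e⟩ := Function.Embedding.nonempty_of_card_le hcard
      refine ⟨(Function.extend e w 0, Function.extend e z fun _ => z₀),
        ⟨⟨fun i => ?_, ?_⟩, fun i _ => ?_⟩, ?_⟩
      · by_cases h : ∃ j, e j = i
        · obtain ⟨j, rfl⟩ := h
          simpa [e.injective.extend_apply] using (hw j).le
        · simp [Function.extend_apply' _ _ _ h]
      · rw [← hw1]
        exact (Fintype.sum_of_injective e e.injective _ _
          (fun i hi => by simpa using Function.extend_apply' w (0 : Fin N → ℝ) i hi)
          fun j => by simp [e.injective.extend_apply]).symm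
      · by_cases h : ∃ j, e j = i
        · obtain ⟨j, rfl⟩ := h
          simpa [e.injective.extend_apply] using hz (Set.mem_range_self j)
        · simpa [Function.extend_apply' _ _ _ h] using hz₀
      · rw [← hx]
        exact (Fintype.sum_of_injective e e.injective _ _
          (fun i hi => by simp [Function.extend_apply' w (0 : Fin N → ℝ) i hi])
          fun j => by simp [e.injective.extend_apply]).symm
  rw [← himg]
  exact ((isCompact_stdSimplex ℝ (Fin N)).prod (isCompact_univ_pi fun _ => hK)).image hΦc

/-- A closed convex set contains the countable convex combinations of its points. -/
theorem mem_of_hasSum_smul {ι : Type*} {C : Set E} (hC : Convex ℝ C) (hcl : IsClosed C)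
    {c : ι → ℝ} (hc : ∀ i, 0 ≤ c i) (hc1 : HasSum c 1) {x : ι → E} (hx : ∀ i, x i ∈ C) {y : E}
    (hy : HasSum (fun i => c i • x i) y) : y ∈ C := by
  have ht : Filter.Tendsto (fun s : Finset ι => s.centerMass c x) Filter.atTop (nhds y) := by
    have := (hc1.inv₀ one_ne_zero).smul hy
    simpa [Finset.centerMass] using this
  refine hcl.mem_of_tendsto ht ?_
  filter_upwards [hc1.eventually_const_lt zero_lt_one] with s hs
  exact hC.centerMass_mem (fun i _ => hc i) hs fun i _ => hx i

end Convex

/-! ### Reduction of the auxiliary alphabet -/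

section Auxiliary

variable {X Y α β ι : Type*} [Fintype X] [Fintype Y] [Fintype α] [Fintype β]

/-- The measure on `X × Y` obtained from the measure `q` on `X` and the conditional law of the
second coordinate given the first under `p`. It vanishes at those `x` that have no mass under `p`.
-/
def extend (p : X × Y → ℝ) (q : X → ℝ) (w : X × Y) : ℝ := q w.1 * (p w / mass p Prod.fst w.1)

lemma extend_nonneg {p : X × Y → ℝ} (hp : ∀ w, 0 ≤ p w) {q : X → ℝ} (hq : ∀ x, 0 ≤ q x)
    (w : X × Y) : 0 ≤ extend p q w :=
  mul_nonneg (hq _) (div_nonneg (hp _) (mass_nonneg hp _ _))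

lemma extend_smul (p : X × Y → ℝ) (c : ℝ) (q : X → ℝ) :
    extend p (fun x => c * q x) = fun w => c * extend p q w := by
  funext w
  simp [extend, mul_assoc]

lemma extend_fst {p : X × Y → ℝ} (hp : ∀ w, 0 ≤ p w) : extend p (mass p Prod.fst) = p := by
  funext w
  by_cases h : mass p Prod.fst w.1 = 0
  · have := le_mass hp Prod.fst w
    rw [h] at this
    simp [extend, h, le_antisymm this (hp w)]
  · rw [extend, mul_div_cancel₀ _ h]

lemma hasSum_extend {p : X × Y → ℝ} (hp : ∀ w, 0 ≤ p w) {r : ι → X → ℝ}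
    (hr : ∀ x, HasSum (fun u => r u x) (mass p Prod.fst x)) (w : X × Y) :
    HasSum (fun u => extend p (r u) w) (p w) := by
  have h := (hr w.1).mul_right (p w / mass p Prod.fst w.1)
  have h2 := congrFun (extend_fst hp) w
  rw [extend] at h2
  rwa [h2] at h

/-- Conditioning on the auxiliary variable `u` reduces entropy. -/
lemma hasSum_finEntropy_le {S : Type*} [Fintype S] {p : S → ℝ} (hp : ∀ w, 0 ≤ p w)
    {v : ι → S → ℝ} (hv : ∀ u w, 0 ≤ v u w) (hs : ∀ w, HasSum (fun u => v u w) (p w))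
    (A : S → α) (B : S → β) {b : ℝ} (hb : HasSum (fun u => finEntropy (v u) A B) b) :
    b ≤ finEntropy p A B := by
  rw [finEntropy_eq hp]
  refine hasSum_le (fun u => ?_) hb (hasSum_sum fun w _ =>
    (hs w).mul_right (-Real.log (condProb p A B (A w) (B w))))
  refine finEntropy_le (hv u) (fun _ _ => condProb_nonneg hp _ _ _ _)
    (fun _ => sum_condProb_le_one _ _ _ _) fun w hw => condProb_pos hp A B fun h0 => hw ?_
  exact le_antisymm (h0 ▸ le_hasSum (hs w) u fun i _ => hv i w) (hv u w)

/-- If `p` has decompositions over auxiliary variables for which the entropies `H(F | U, Y)` come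
arbitrarily close to `0` and `H(G | U, F, Y)` arbitrarily close to `H(G | F, Y)`, then it has one
over a finite alphabet for which both values are attained. All triples formed of the posterior law
of `X` and the two entropies lie in a compact set, whose convex hull is compact. -/
theorem exists_finite_decomposition.{v} {p : X × Y → ℝ} (hp : ∀ w, 0 ≤ p w) (hp1 : ∑ w, p w = 1)
    (F : X × Y → α) (G : X × Y → β)
    (h : ∀ δ > 0, ∃ (ι : Type v) (r : ι → X → ℝ) (a b : ℝ), (∀ u x, 0 ≤ r u x) ∧
      (∀ x, HasSum (fun u => r u x) (mass p Prod.fst x)) ∧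
      HasSum (fun u => finEntropy (extend p (r u)) F Prod.snd) a ∧
      HasSum (fun u => finEntropy (extend p (r u)) G fun w => (F w, w.2)) b ∧
      a ≤ δ ∧ finEntropy p G (fun w => (F w, w.2)) - δ ≤ b) :
    ∃ (ι : Type) (_ : Fintype ι) (r : ι → X → ℝ), (∀ u x, 0 ≤ r u x) ∧
      (∀ x, ∑ u, r u x = mass p Prod.fst x) ∧
      ∑ u, finEntropy (extend p (r u)) F Prod.snd = 0 ∧
      ∑ u, finEntropy (extend p (r u)) G (fun w => (F w, w.2)) =
        finEntropy p G fun w => (F w, w.2) := by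
  set Φ : (X → ℝ) → (X → ℝ) × ℝ × ℝ := fun q => (q, finEntropy (extend p q) F Prod.snd,
    finEntropy (extend p q) G fun w => (F w, w.2)) with hΦ
  have hΦc : Continuous Φ := by
    have hext : Continuous (extend p) := by
      unfold extend
      fun_prop
    exact continuous_id.prodMk ((continuous_finEntropy hext F Prod.snd).prodMk
      (continuous_finEntropy hext G fun w => (F w, w.2)))
  have hΦs : ∀ (c : ℝ) (q : X → ℝ), (∀ x, 0 ≤ q x) → Φ (fun x => c * q x) = c • Φ q := by
    intro c q hq
    simp only [hΦ, extend_smul, finEntropy_smul (extend_nonneg hp hq)]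
    rfl
  set C := convexHull ℝ (Φ '' stdSimplex ℝ X) with hCdef
  have hC : IsClosed C :=
    (isCompact_convexHull ((isCompact_stdSimplex ℝ X).image hΦc)).isClosed
  have hpX : mass p Prod.fst ∈ stdSimplex ℝ X :=
    ⟨mass_nonneg hp _, by rw [sum_mass, hp1]⟩
  have hmem : (mass p Prod.fst, (0 : ℝ), finEntropy p G fun w => (F w, w.2)) ∈ C := by
    rw [← hC.closure_eq, Metric.mem_closure_iff]
    intro δ hδ
    obtain ⟨ι, r, a, b, hr, hrs, ha, hb, haδ, hbδ⟩ := h (δ / 2) (half_pos hδ)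
    have ha0 : 0 ≤ a := ha.nonneg fun u => finEntropy_nonneg (extend_nonneg hp (hr u)) _ _
    have hb0 := hasSum_finEntropy_le hp (fun u => extend_nonneg hp (hr u)) (hasSum_extend hp hrs)
      _ _ hb
    refine ⟨(mass p Prod.fst, a, b), ?_, ?_⟩
    · have hq : ∀ u, ∃ q ∈ stdSimplex ℝ X, r u = fun x => (∑ x, r u x) * q x := fun u => by
        by_cases hu : ∑ x, r u x = 0
        · refine ⟨_, hpX, funext fun x => ?_⟩
          rw [hu, zero_mul]
          exact (Finset.sum_eq_zero_iff_of_nonneg fun x _ => hr u x).1 hu x (Finset.mem_univ x)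
        · refine ⟨fun x => r u x / ∑ x, r u x, ⟨fun x => div_nonneg (hr u x)
            (Finset.sum_nonneg fun x _ => hr u x), ?_⟩, funext fun x => ?_⟩
          · rw [← Finset.sum_div, div_self hu]
          · rw [mul_div_cancel₀ _ hu]
      choose q hq hrq using hq
      refine mem_of_hasSum_smul (convex_convexHull ℝ _) hC (c := fun u => ∑ x, r u x)
        (fun u => Finset.sum_nonneg fun x _ => hr u x) ?_
        (fun u => subset_convexHull ℝ _ ⟨q u, hq u, rfl⟩) (y := (mass p Prod.fst, a, b)) ?_
      · have := hasSum_sum fun x (_ : x ∈ Finset.univ) => hrs x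
        rwa [sum_mass, hp1] at this
      · have hu : ∀ u, (∑ x, r u x) • Φ (q u) = Φ (r u) := fun u => by
          rw [← hΦs _ _ (hq u).1, ← hrq u]
        simp only [hu]
        exact (Pi.hasSum.2 hrs).prodMk (ha.prodMk hb)
    · simp only [Prod.dist_eq, dist_self, Real.dist_eq]
      refine max_lt hδ (max_lt ?_ ?_)
      · rw [zero_sub, abs_neg, abs_of_nonneg ha0]
        linarith
      · rw [abs_of_nonneg (by linarith)]
        linarith
  obtain ⟨ι, hι, c, z, hc, -, hz, hcz⟩ := mem_convexHull_iff_exists_fintype.1 hmem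
  choose q hq hqz using hz
  have hs : ∀ u, c u • z u = Φ fun x => c u * q u x := fun u => by
    rw [hΦs _ _ (hq u).1, hqz u]
  simp only [hs, hΦ] at hcz
  refine ⟨ι, hι, fun u x => c u * q u x, fun u x => mul_nonneg (hc u) ((hq u).1 x),
    fun x => ?_, ?_, ?_⟩
  · simpa [Prod.fst_sum] using congrFun (congrArg Prod.fst hcz) x
  · simpa [Prod.snd_sum, Prod.fst_sum] using congrArg (fun c => c.2.1) hcz
  · simpa [Prod.snd_sum, Prod.fst_sum] using congrArg (fun c => c.2.2) hcz

end Auxiliary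

/-! ### The auxiliary variable of a perfectly secure computation -/

section Perfect

variable {𝒳 𝒴 ℱ 𝒢 𝒰 : Type*}

lemma bind_map_mk_apply {S : Type*} (P : PMF S) (q : S → PMF 𝒰) (s : S) (u : 𝒰) :
    (P.bind fun s => (q s).map fun u => (s, u)) (s, u) = P s * q s u := by
  classical
  rw [PMF.bind_apply, tsum_eq_single s]
  · rw [PMF.map_apply, tsum_eq_single u]
    · simp
    · intro u' hu'
      simp [hu'.symm]
  · intro s' hs'
    simp [PMF.map_apply, hs'.symm]

lemma auxLaw_apply (pXY : PMF (𝒳 × 𝒴)) (pU : 𝒳 → 𝒴 → PMF 𝒰) (w : 𝒳 × 𝒴) (u : 𝒰) :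
    auxLaw pXY pU (w, u) = pXY w * pU w.1 w.2 u :=
  bind_map_mk_apply pXY (fun w => pU w.1 w.2) w u

lemma prob_auxLaw (pXY : PMF (𝒳 × 𝒴)) (pU : 𝒳 → 𝒴 → PMF 𝒰) (w : 𝒳 × 𝒴) (u : 𝒰) :
    prob (auxLaw pXY pU) (fun ω => (ω.2, ω.1)) (u, w) =
      (pXY w).toReal * (pU w.1 w.2 u).toReal := by
  have := prob_of_injective (auxLaw pXY pU) (E := fun ω => (ω.2, ω.1)) Prod.swap_injective (w, u)
  rw [this, auxLaw_apply, ENNReal.toReal_mul]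

lemma prob_auxLaw_fst (pXY : PMF (𝒳 × 𝒴)) (pU : 𝒳 → 𝒴 → PMF 𝒰) :
    prob (auxLaw pXY pU) Prod.fst = fun w => (pXY w).toReal := by
  funext w
  have : (auxLaw pXY pU).map Prod.fst = pXY := by
    simp [auxLaw, PMF.map, Function.comp_def]
  rw [prob, this]

lemma prob_auxLaw_triple (pXY : PMF (𝒳 × 𝒴)) (pU : 𝒳 → 𝒴 → PMF 𝒰) (u : 𝒰) (x : 𝒳) (y : 𝒴) :
    prob (auxLaw pXY pU) (fun ω => (ω.2, ω.1.1, ω.1.2)) (u, x, y) =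
      (pXY (x, y)).toReal * (pU x y u).toReal := by
  have := prob_of_injective (auxLaw pXY pU) (E := fun ω => (ω.2, ω.1.1, ω.1.2))
    Prod.swap_injective ((x, y), u)
  rw [this, auxLaw_apply, ENNReal.toReal_mul]

variable [Fintype 𝒳] [Fintype 𝒴]

lemma prob_auxLaw_X (pXY : PMF (𝒳 × 𝒴)) (pU : 𝒳 → 𝒴 → PMF 𝒰) (x : 𝒳) :
    prob (auxLaw pXY pU) (fun ω => ω.1.1) x = mass (fun w => (pXY w).toReal) Prod.fst x := by
  rw [← prob_auxLaw_fst pXY pU]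
  exact prob_comp (auxLaw pXY pU) Prod.fst Prod.fst x

lemma isMarkovChain_auxLaw (pXY : PMF (𝒳 × 𝒴)) (K : 𝒳 → PMF 𝒰) :
    IsMarkovChain (auxLaw pXY fun x _ => K x) (fun ω => ω.2) (fun ω => ω.1.1)
      (fun ω => ω.1.2) := by
  intro u x y
  have h1 : prob (auxLaw pXY fun x _ => K x) (fun ω => (ω.2, ω.1.1)) (u, x) =
      mass (fun w => (pXY w).toReal) Prod.fst x * (K x u).toReal := by
    rw [prob_eq_mass_slice _ (fun ω => ω.2) (fun ω => ω.1) (m := u) (D := Prod.fst) (d := x)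
      fun ω => by simp]
    simp only [prob_auxLaw, mass, Finset.sum_mul, ite_mul, zero_mul]
    exact Finset.sum_congr rfl fun w _ => by split_ifs with h <;> simp [h]
  have h2 : prob (auxLaw pXY fun x _ => K x) (fun ω => (ω.1.1, ω.1.2)) (x, y) =
      (pXY (x, y)).toReal :=
    congrFun (prob_auxLaw_fst pXY fun x _ => K x) (x, y)
  rw [prob_auxLaw_triple, prob_auxLaw_X, h1, h2]
  ring

/-- By the Markov chain condition the auxiliary variable may be drawn by Alice alone. -/
lemma exists_kernel_of_isMarkovChain {pXY : PMF (𝒳 × 𝒴)} {pU : 𝒳 → 𝒴 → PMF 𝒰}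
    (h : IsMarkovChain (auxLaw pXY pU) (fun ω => ω.2) (fun ω => ω.1.1) (fun ω => ω.1.2)) :
    ∃ K : 𝒳 → PMF 𝒰, ∀ x y, pXY (x, y) ≠ 0 → pU x y = K x := by
  classical
  obtain ⟨⟨-, y₀⟩, -⟩ := pXY.support_nonempty
  refine ⟨fun x => pU x (if h : ∃ y, pXY (x, y) ≠ 0 then h.choose else y₀), fun x y hxy => ?_⟩
  have hex : ∃ y, pXY (x, y) ≠ 0 := ⟨y, hxy⟩
  have key : ∀ y u, pXY (x, y) ≠ 0 → (pU x y u).toReal =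
      prob (auxLaw pXY pU) (fun ω => (ω.2, ω.1.1)) (u, x) /
        mass (fun w => (pXY w).toReal) Prod.fst x := fun y u hy => by
    have h1 := h u x y
    have h2 : prob (auxLaw pXY pU) (fun ω => (ω.1.1, ω.1.2)) (x, y) = (pXY (x, y)).toReal :=
      congrFun (prob_auxLaw_fst pXY pU) (x, y)
    have hp : (pXY (x, y)).toReal ≠ 0 :=
      (ENNReal.toReal_pos hy (PMF.apply_ne_top _ _)).ne'
    have hX := mass_pos (v := fun w => (pXY w).toReal) (fun _ => ENNReal.toReal_nonneg) Prod.fst hp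
    rw [prob_auxLaw_triple, prob_auxLaw_X, h2] at h1
    rw [eq_div_iff hX.ne']
    apply mul_left_cancel₀ hp
    linear_combination h1
  simp only [dif_pos hex]
  ext u
  rw [← ENNReal.toReal_eq_toReal_iff' (PMF.apply_ne_top _ _) (PMF.apply_ne_top _ _),
    key y u hxy, key _ u hex.choose_spec]

variable [Fintype ℱ] [Fintype 𝒢]

lemma hasSum_auxLaw_F (pXY : PMF (𝒳 × 𝒴)) (pU : 𝒳 → 𝒴 → PMF 𝒰) (f : 𝒳 → 𝒴 → ℱ) :
    HasSum (fun u => finEntropy (fun w => (pXY w).toReal * (pU w.1 w.2 u).toReal)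
      (fun w => f w.1 w.2) Prod.snd)
      (condEntropy (auxLaw pXY pU) (fun ω => f ω.1.1 ω.1.2) fun ω => (ω.2, ω.1.2)) := by
  have := hasSum_finEntropy_slice (auxLaw pXY pU) (fun ω => ω.2) (fun ω => ω.1)
    (fun w => f w.1 w.2) Prod.snd
  simpa only [prob_auxLaw] using this

lemma hasSum_auxLaw_G (pXY : PMF (𝒳 × 𝒴)) (pU : 𝒳 → 𝒴 → PMF 𝒰) (f : 𝒳 → 𝒴 → ℱ)
    (g : 𝒳 → 𝒴 → 𝒢) :
    HasSum (fun u => finEntropy (fun w => (pXY w).toReal * (pU w.1 w.2 u).toReal)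
      (fun w => g w.1 w.2) fun w => (f w.1 w.2, w.2))
      (finEntropy (fun w => (pXY w).toReal) (fun w => g w.1 w.2) (fun w => (f w.1 w.2, w.2)) -
        condMutualInfo (auxLaw pXY pU) (fun ω => ω.2) (fun ω => g ω.1.1 ω.1.2)
          fun ω => (f ω.1.1 ω.1.2, ω.1.2)) := by
  have := hasSum_condMutualInfo (auxLaw pXY pU) (fun ω => ω.2) (fun ω => ω.1)
    (fun w => g w.1 w.2) fun w => (f w.1 w.2, w.2)
  rw [← prob_auxLaw_fst pXY pU]
  simpa only [prob_auxLaw] using this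

/-- A finite decomposition of the law of `X` is an auxiliary variable `U`. -/
theorem perfectlySecurelyComputable_of_decomposition (pXY : PMF (𝒳 × 𝒴)) (f : 𝒳 → 𝒴 → ℱ)
    (g : 𝒳 → 𝒴 → 𝒢) {ι : Type} [Fintype ι] {r : ι → 𝒳 → ℝ} (hr : ∀ u x, 0 ≤ r u x)
    (hrs : ∀ x, ∑ u, r u x = mass (fun w => (pXY w).toReal) Prod.fst x)
    (hF : ∑ u, finEntropy (extend (fun w => (pXY w).toReal) (r u)) (fun w => f w.1 w.2)
      Prod.snd = 0)
    (hG : ∑ u, finEntropy (extend (fun w => (pXY w).toReal) (r u)) (fun w => g w.1 w.2)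
        (fun w => (f w.1 w.2, w.2)) =
      finEntropy (fun w => (pXY w).toReal) (fun w => g w.1 w.2) fun w => (f w.1 w.2, w.2)) :
    PerfectlySecurelyComputable pXY f g := by
  classical
  set p : 𝒳 × 𝒴 → ℝ := fun w => (pXY w).toReal with hp
  have hp0 : ∀ w, 0 ≤ p w := fun w => ENNReal.toReal_nonneg
  have hK : ∀ x, ∃ K : PMF ι, mass p Prod.fst x ≠ 0 →
      ∀ u, (K u).toReal = r u x / mass p Prod.fst x := fun x => by
    by_cases hx : mass p Prod.fst x = 0
    · have : Nonempty ι := by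
        by_contra hι
        rw [not_nonempty_iff] at hι
        have h1 := sum_mass p Prod.fst
        rw [Finset.sum_congr rfl fun x _ => (hrs x).symm, sum_toReal_pmf pXY] at h1
        simp at h1
      exact ⟨PMF.pure this.some, fun h => absurd hx h⟩
    · refine ⟨PMF.ofFintype (fun u => ENNReal.ofReal (r u x / mass p Prod.fst x)) ?_, fun _ u => ?_⟩
      · rw [← ENNReal.ofReal_sum_of_nonneg fun u _ => div_nonneg (hr u x) (mass_nonneg hp0 _ _),
          ← Finset.sum_div, hrs, div_self hx, ENNReal.ofReal_one]
      · rw [PMF.ofFintype_apply, ENNReal.toReal_ofReal (div_nonneg (hr u x) (mass_nonneg hp0 _ _))]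
  choose K hK using hK
  have hv : ∀ u, (fun w => (pXY w).toReal * (K w.1 u).toReal) = extend p (r u) := fun u => by
    funext w
    by_cases hw : (pXY w).toReal = 0
    · simp [extend, hp, hw]
    · have := (mass_pos hp0 Prod.fst hw).ne'
      rw [extend, hK _ this]
      ring
  have h1 := (hasSum_auxLaw_F pXY (fun x _ => K x) f).unique (hasSum_fintype _)
  have h2 := (hasSum_auxLaw_G pXY (fun x _ => K x) f g).unique (hasSum_fintype _)
  simp only [hv] at h1 h2
  exact ⟨ι, inferInstance, fun x _ => K x, isMarkovChain_auxLaw pXY K, h1.trans hF, by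
    rw [hG] at h2; linarith⟩

end Perfect

/-! ### Products of measures -/

section Product

variable {S α β δ : Type*} [Fintype S] {n : ℕ}

lemma iid_apply_toReal (p : PMF S) (w : Fin n → S) :
    (iid p n w).toReal = ∏ i, (p (w i)).toReal := by
  rw [iid, PMF.ofFintype_apply, ENNReal.toReal_prod]

lemma mass_prod (v : Fin n → S → ℝ) (D : S → δ) (d : Fin n → δ) :
    mass (fun w : Fin n → S => ∏ i, v i (w i)) (fun w i => D (w i)) d =
      ∏ i, mass (v i) D (d i) := by
  classical
  simp only [mass, Finset.prod_univ_sum, Fintype.piFinset_univ]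
  refine Finset.sum_congr rfl fun w _ => ?_
  by_cases h : (fun i => D (w i)) = d
  · rw [if_pos h]
    exact Finset.prod_congr rfl fun i _ => by rw [if_pos (congrFun h i)]
  · rw [if_neg h]
    obtain ⟨i, hi⟩ := Function.ne_iff.1 h
    exact (Finset.prod_eq_zero (Finset.mem_univ i) (if_neg hi)).symm

lemma mass_prod_pair (v : Fin n → S → ℝ) (A : S → α) (B : S → β) (a : Fin n → α)
    (b : Fin n → β) :
    mass (fun w : Fin n → S => ∏ i, v i (w i)) (fun w => (fun i => A (w i), fun i => B (w i)))
      (a, b) = ∏ i, mass (v i) (fun s => (A s, B s)) (a i, b i) := by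
  rw [← mass_prod v (fun s => (A s, B s)) fun i => (a i, b i)]
  refine mass_congr fun w _ => ?_
  simp only [Prod.ext_iff, funext_iff, forall_and]

/-- If the conditional laws of `A` given `B` under the factors are all given by `Q`, the
conditional law under the product is the product of the `Q`s. -/
lemma finEntropy_prod {v : Fin n → S → ℝ} (hv : ∀ i s, 0 ≤ v i s) (A : S → α) (B : S → β)
    (Q : S → ℝ) (hQ : ∀ i s, v i s ≠ 0 →
      mass (v i) (fun s => (A s, B s)) (A s, B s) = Q s * mass (v i) B (B s)) :
    finEntropy (fun w : Fin n → S => ∏ i, v i (w i)) (fun w i => A (w i)) (fun w i => B (w i)) =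
      ∑ w : Fin n → S, (∏ i, v i (w i)) * ∑ i, -Real.log (Q (w i)) := by
  refine Finset.sum_congr rfl fun w _ => ?_
  by_cases hw : ∏ i, v i (w i) = 0
  · simp [hw]
  have hw' : ∀ i, v i (w i) ≠ 0 := fun i => Finset.prod_ne_zero_iff.1 hw i (Finset.mem_univ i)
  have hB : ∀ i, mass (v i) B (B (w i)) ≠ 0 := fun i => (mass_pos (hv i) B (hw' i)).ne'
  have hAB : ∀ i, mass (v i) (fun s => (A s, B s)) (A (w i), B (w i)) ≠ 0 := fun i =>
    (mass_pos (hv i) (fun s => (A s, B s)) (hw' i)).ne'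
  rw [mass_prod, mass_prod_pair, Real.log_prod fun i _ => hB i, Real.log_prod fun i _ => hAB i,
    ← Finset.sum_sub_distrib]
  congr 1
  refine Finset.sum_congr rfl fun i _ => ?_
  have hQ0 : Q (w i) ≠ 0 := fun h => hAB i (by rw [hQ i _ (hw' i), h, zero_mul])
  rw [hQ i _ (hw' i), Real.log_mul hQ0 (hB i)]
  ring

lemma sum_prod_mul_apply {p : S → ℝ} (hp1 : ∑ s, p s = 1) (i : Fin n) (h : S → ℝ) :
    ∑ w : Fin n → S, (∏ j, p (w j)) * h (w i) = ∑ s, p s * h s := by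
  classical
  have h1 : ∀ w : Fin n → S, (∏ j, p (w j)) * h (w i) =
      ∏ j, p (w j) * if j = i then h (w j) else 1 := fun w => by
    rw [Finset.prod_mul_distrib, Finset.prod_ite_eq' Finset.univ i fun j => h (w j)]
    simp
  have h2 : ∀ j, ∑ s, p s * (if j = i then h s else 1) = if j = i then ∑ s, p s * h s else 1 :=
    fun j => by split_ifs <;> simp [hp1]
  rw [Finset.sum_congr rfl fun w _ => h1 w, ← Fintype.piFinset_univ,
    ← Finset.prod_univ_sum (fun _ => Finset.univ) fun j s => p s * if j = i then h s else 1,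
    Finset.prod_congr rfl fun j _ => h2 j]
  simp

/-- The conditional entropy of independent copies is additive. -/
lemma finEntropy_iid {p : S → ℝ} (hp : ∀ s, 0 ≤ p s) (hp1 : ∑ s, p s = 1) (A : S → α)
    (B : S → β) :
    finEntropy (fun w : Fin n → S => ∏ i, p (w i)) (fun w i => A (w i)) (fun w i => B (w i)) =
      n * finEntropy p A B := by
  rw [finEntropy_prod (fun _ => hp) A B (fun s => condProb p A B (A s) (B s)) fun _ s hs => by
    rw [condProb, div_mul_cancel₀ _ (mass_pos hp B hs).ne']]
  simp only [Finset.mul_sum]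
  rw [Finset.sum_comm, Finset.sum_congr rfl fun i _ => sum_prod_mul_apply hp1 i
    fun s => -Real.log (condProb p A B (A s) (B s)), ← finEntropy_eq hp]
  simp

end Product

/-! ### From perfect to asymptotic security -/

section Achievability

variable {Ω Ω' S α β γ 𝒰 : Type*}

/-- The law of independent random variables with laws `q i`. -/
def piPMF [Countable 𝒰] {n : ℕ} (q : Fin n → PMF 𝒰) : PMF (Fin n → 𝒰) :=
  letI : MeasurableSpace 𝒰 := ⊤
  (MeasureTheory.Measure.pi fun i => (q i).toMeasure).toPMF

lemma piPMF_apply [Countable 𝒰] {n : ℕ} (q : Fin n → PMF 𝒰) (u : Fin n → 𝒰) :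
    piPMF q u = ∏ i, q i (u i) := by
  let _ : MeasurableSpace 𝒰 := ⊤
  rw [piPMF, MeasureTheory.Measure.toPMF_apply, MeasureTheory.Measure.pi_singleton]
  exact Finset.prod_congr rfl fun i _ => PMF.toMeasure_apply_singleton _ _ (by trivial)

lemma prob_map (P : PMF Ω) (h : Ω → Ω') (A : Ω' → α) :
    prob (P.map h) A = prob P fun ω => A (h ω) := by
  funext a
  rw [prob, PMF.map_comp]
  rfl

lemma condMutualInfo_map [Fintype γ] (P : PMF Ω) (h : Ω → Ω') (A : Ω' → α) (C : Ω' → γ)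
    (B : Ω' → β) : condMutualInfo (P.map h) A C B =
      condMutualInfo P (fun ω => A (h ω)) (fun ω => C (h ω)) fun ω => B (h ω) := by
  simp only [condMutualInfo, condEntropy, prob_map]

lemma eq_of_finEntropy_eq_zero [Fintype S] {v : S → ℝ} (hv : ∀ s, 0 ≤ v s) {A : S → α}
    {B : S → β} (h : finEntropy v A B = 0) {s t : S} (hs : v s ≠ 0) (ht : v t ≠ 0)
    (hst : B s = B t) : A s = A t := by
  classical
  rw [finEntropy_eq hv] at h
  have h1 := (Finset.sum_eq_zero_iff_of_nonneg fun s _ => mul_nonneg (hv s) (neg_nonneg.2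
    (Real.log_nonpos (condProb_nonneg hv A B _ _) (condProb_le_one hv A B _ _)))).1 h s
      (Finset.mem_univ s)
  have h2 : condProb v A B (A s) (B s) = 1 :=
    Real.eq_one_of_pos_of_log_eq_zero (condProb_pos hv A B hs)
      (by simpa [hs] using h1)
  rw [condProb, div_eq_one_iff_eq (mass_pos hv B hs).ne'] at h2
  by_contra hne
  refine h2.not_lt (Finset.sum_lt_sum (fun r _ => ?_) ⟨t, Finset.mem_univ t, ?_⟩)
  · by_cases hr : B r = B s <;> by_cases hr' : A r = A s <;> simp [hr, hr', hv]
  · simpa [hst, Ne.symm hne] using (hv t).lt_of_ne' ht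

lemma map_congr_of_support {P : PMF Ω} {h h' : Ω → Ω'} (hh : ∀ ω, P ω ≠ 0 → h ω = h' ω) :
    P.map h = P.map h' := by
  classical
  ext b
  simp only [PMF.map_apply]
  refine tsum_congr fun ω => ?_
  by_cases h0 : P ω = 0
  · simp [h0]
  · rw [hh ω h0]

/-- If conditioning also on `u` does not reduce the entropy of `A` given `B`, then the conditional
law of `A` given `B` does not depend on `u`. -/
lemma mass_eq_of_hasSum_finEntropy {ι : Type*} [Fintype S] [Fintype α] [Fintype β] {p : S → ℝ}
    (hp : ∀ s, 0 ≤ p s) {v : ι → S → ℝ} (hv : ∀ u s, 0 ≤ v u s)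
    (hvs : ∀ s, HasSum (fun u => v u s) (p s)) (A : S → α) (B : S → β)
    (h : HasSum (fun u => finEntropy (v u) A B) (finEntropy p A B)) {u : ι} {s : S}
    (hs : v u s ≠ 0) :
    mass (v u) (fun s => (A s, B s)) (A s, B s) =
      condProb p A B (A s) (B s) * mass (v u) B (B s) := by
  have hQ0 : ∀ a b, 0 ≤ condProb p A B a b := fun _ _ => condProb_nonneg hp _ _ _ _
  have hQ1 : ∀ b, ∑ a, condProb p A B a b ≤ 1 := fun _ => sum_condProb_le_one _ _ _ _
  have hQp : ∀ u s, v u s ≠ 0 → 0 < condProb p A B (A s) (B s) := fun u s hs =>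
    condProb_pos hp A B fun h0 => hs
      (le_antisymm (h0 ▸ le_hasSum (hvs s) u fun i _ => hv i s) (hv u s))
  have h1 : HasSum (fun u => ∑ s, v u s * -Real.log (condProb p A B (A s) (B s)))
      (finEntropy p A B) := by
    rw [finEntropy_eq hp]
    exact hasSum_sum fun s _ => (hvs s).mul_right _
  have hle : ∀ u, finEntropy (v u) A B ≤ ∑ s, v u s * -Real.log (condProb p A B (A s) (B s)) :=
    fun u => finEntropy_le (hv u) hQ0 hQ1 (hQp u)
  have h2 := h1.sub h
  rw [sub_self, hasSum_zero_iff_of_nonneg fun u => sub_nonneg.2 (hle u)] at h2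
  exact mass_eq_of_finEntropy_eq (hv u) hQ0 hQ1 (hQp u) (sub_eq_zero.1 (congrFun h2 u)).symm hs

variable {𝒳 𝒴 ℱ 𝒢 : Type*} [Fintype 𝒳] [Fintype 𝒴]

/-- From a perfectly secure auxiliary variable: Alice can draw `U` from `K`, Bob can decode `F`, and
the conditional law of `G` given `(F, Y)` is the same under each value of `U`. -/
lemma PerfectlySecurelyComputable.exists_kernel [Fintype ℱ] [Fintype 𝒢]
    {pXY : PMF (𝒳 × 𝒴)} {f : 𝒳 → 𝒴 → ℱ} {g : 𝒳 → 𝒴 → 𝒢} (h : PerfectlySecurelyComputable pXY f g) :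
    ∃ (𝒰 : Type) (_ : Countable 𝒰) (K : 𝒳 → PMF 𝒰) (dec : 𝒰 → 𝒴 → ℱ),
      (∀ u w, (pXY w).toReal * (K w.1 u).toReal ≠ 0 → dec u w.2 = f w.1 w.2) ∧
      ∀ u w, (pXY w).toReal * (K w.1 u).toReal ≠ 0 →
        mass (fun w => (pXY w).toReal * (K w.1 u).toReal)
            (fun w => (g w.1 w.2, f w.1 w.2, w.2)) (g w.1 w.2, f w.1 w.2, w.2) =
          condProb (fun w => (pXY w).toReal) (fun w => g w.1 w.2) (fun w => (f w.1 w.2, w.2))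
              (g w.1 w.2) (f w.1 w.2, w.2) *
            mass (fun w => (pXY w).toReal * (K w.1 u).toReal) (fun w => (f w.1 w.2, w.2))
              (f w.1 w.2, w.2) := by
  classical
  obtain ⟨𝒰, hcount, pU, hM, hF, hG⟩ := h
  obtain ⟨K, hK⟩ := exists_kernel_of_isMarkovChain hM
  set p : 𝒳 × 𝒴 → ℝ := fun w => (pXY w).toReal with hp
  have hp0 : ∀ w, 0 ≤ p w := fun w => ENNReal.toReal_nonneg
  set v : 𝒰 → 𝒳 × 𝒴 → ℝ := fun u w => p w * (K w.1 u).toReal with hvdef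
  have hv0 : ∀ u w, 0 ≤ v u w := fun u w => mul_nonneg (hp0 w) ENNReal.toReal_nonneg
  have hv : ∀ u, (fun w => (pXY w).toReal * (pU w.1 w.2 u).toReal) = v u := fun u => by
    funext w
    by_cases hw : pXY w = 0
    · simp [hvdef, hp, hw]
    · simp only [hvdef, hp, hK w.1 w.2 hw]
  have hvs : ∀ w, HasSum (fun u => v u w) (p w) := fun w => by
    have h1 := hasSum_prob (auxLaw pXY pU) (fun ω => ω.2) Prod.fst w
    rw [prob_auxLaw_fst] at h1
    simp only [prob_auxLaw] at h1
    simpa only [← hv] using h1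
  have hsF := hasSum_auxLaw_F pXY pU f
  have hsG := hasSum_auxLaw_G pXY pU f g
  rw [hF] at hsF
  rw [hG, sub_zero] at hsG
  simp only [hv] at hsF hsG
  have hcond : ∀ u w, v u w ≠ 0 →
      mass (v u) (fun w => (g w.1 w.2, f w.1 w.2, w.2)) (g w.1 w.2, f w.1 w.2, w.2) =
        condProb p (fun w => g w.1 w.2) (fun w => (f w.1 w.2, w.2)) (g w.1 w.2)
          (f w.1 w.2, w.2) * mass (v u) (fun w => (f w.1 w.2, w.2)) (f w.1 w.2, w.2) := by
    intro u w hw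
    exact mass_eq_of_hasSum_finEntropy hp0 hv0 hvs (fun w => g w.1 w.2)
      (fun w => (f w.1 w.2, w.2)) hsG hw
  have hdet : ∀ u x x' y, v u (x, y) ≠ 0 → v u (x', y) ≠ 0 → f x y = f x' y := by
    intro u x x' y hx hx'
    have h1 := (hasSum_zero_iff_of_nonneg fun u =>
      finEntropy_nonneg (hv0 u) (fun w => f w.1 w.2) Prod.snd).1 hsF
    exact eq_of_finEntropy_eq_zero (hv0 u) (congrFun h1 u) hx hx' rfl
  obtain ⟨⟨x₀, -⟩, -⟩ := pXY.support_nonempty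
  set dec : 𝒰 → 𝒴 → ℱ := fun u y =>
    if h : ∃ x, v u (x, y) ≠ 0 then f h.choose y else f x₀ y with hdec
  have hdecv : ∀ u w, v u w ≠ 0 → dec u w.2 = f w.1 w.2 := fun u w hw => by
    have hex : ∃ x, v u (x, w.2) ≠ 0 := ⟨w.1, hw⟩
    simp only [hdec, dif_pos hex]
    exact hdet u _ _ _ hex.choose_spec hw
  exact ⟨𝒰, hcount, K, dec, hdecv, hcond⟩

/-- The protocol in which Alice sends independent copies of an auxiliary variable and Bob decodes
each of them separately. -/
abbrev copyProtocol {𝒰 : Type} [Countable 𝒰] (K : 𝒳 → PMF 𝒰) (dec : 𝒰 → 𝒴 → ℱ) (n : ℕ) :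
    Protocol 𝒳 𝒴 ℱ n where
  Msg := Fin n → 𝒰
  countable_msg := inferInstance
  alice x := piPMF fun i => K (x i)
  bob m y := PMF.pure fun i => dec (m i) (y i)

/-- The joint law of the inputs and the message of `copyProtocol`. -/
def copyLaw {𝒰 : Type} [Countable 𝒰] (pXY : PMF (𝒳 × 𝒴)) (K : 𝒳 → PMF 𝒰) (n : ℕ) :
    PMF ((Fin n → 𝒳 × 𝒴) × (Fin n → 𝒰)) :=
  (iid pXY n).bind fun w => (piPMF fun i => K (w i).1).map fun m => (w, m)

section Copy

variable {𝒰 : Type} [Countable 𝒰] (pXY : PMF (𝒳 × 𝒴)) (K : 𝒳 → PMF 𝒰)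

lemma copyLaw_apply_toReal {n : ℕ} (w : Fin n → 𝒳 × 𝒴) (m : Fin n → 𝒰) :
    (copyLaw pXY K n (w, m)).toReal = ∏ i, (pXY (w i)).toReal * (K (w i).1 (m i)).toReal := by
  rw [copyLaw, bind_map_mk_apply (iid pXY n) (fun w => piPMF fun i => K (w i).1),
    ENNReal.toReal_mul, iid_apply_toReal, piPMF_apply, ENNReal.toReal_prod,
    ← Finset.prod_mul_distrib]

lemma prob_copyLaw {n : ℕ} (m : Fin n → 𝒰) (w : Fin n → 𝒳 × 𝒴) :
    prob (copyLaw pXY K n) (fun c => (c.2, c.1)) (m, w) =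
      ∏ i, (pXY (w i)).toReal * (K (w i).1 (m i)).toReal := by
  rw [← copyLaw_apply_toReal]
  exact prob_of_injective (copyLaw pXY K n) (E := fun c => (c.2, c.1)) Prod.swap_injective (w, m)

lemma prob_copyLaw_fst {n : ℕ} : prob (copyLaw pXY K n) (fun c => c.1) =
    fun w => ∏ i, (pXY (w i)).toReal := by
  funext w
  have : (copyLaw pXY K n).map (fun c => c.1) = iid pXY n := by
    simp [copyLaw, PMF.map, Function.comp_def]
  rw [prob, this, iid_apply_toReal]

lemma law_copyProtocol {f : 𝒳 → 𝒴 → ℱ} {dec : 𝒰 → 𝒴 → ℱ}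
    (hdec : ∀ u w, (pXY w).toReal * (K w.1 u).toReal ≠ 0 → dec u w.2 = f w.1 w.2) (n : ℕ) :
    (copyProtocol K dec n).law pXY =
      (copyLaw pXY K n).map fun c => (c.1, c.2, fun i => f (c.1 i).1 (c.1 i).2) := by
  have h1 : (copyProtocol K dec n).law pXY =
      (copyLaw pXY K n).map fun c => (c.1, c.2, fun i => dec (c.2 i) (c.1 i).2) := by
    simp only [Protocol.law, copyProtocol, copyLaw, PMF.map_bind, PMF.map_comp, PMF.pure_map]
    rfl
  rw [h1]
  refine map_congr_of_support fun c hc => ?_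
  have h3 : ∏ i, (pXY (c.1 i)).toReal * (K (c.1 i).1 (c.2 i)).toReal ≠ 0 := by
    rw [← copyLaw_apply_toReal]
    exact (ENNReal.toReal_pos hc (PMF.apply_ne_top _ _)).ne'
  have h4 : (fun i => dec (c.2 i) (c.1 i).2) = fun i => f (c.1 i).1 (c.1 i).2 :=
    funext fun i => hdec _ _ (Finset.prod_ne_zero_iff.1 h3 i (Finset.mem_univ i))
  rw [h4]

lemma finEntropy_pair_pi {S α β γ : Type*} [Fintype S] {n : ℕ} (q : (Fin n → S) → ℝ) (A : S → α)
    (B : S → β) (C : S → γ) :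
    finEntropy q (fun w i => A (w i)) (fun w => (fun i => B (w i), fun i => C (w i))) =
      finEntropy q (fun w i => A (w i)) fun w i => (B (w i), C (w i)) :=
  finEntropy_congr (fun _ _ _ _ => Iff.rfl) fun w w' _ _ => by
    simp only [Prod.ext_iff, funext_iff, forall_and]

lemma condMutualInfo_copyLaw [Fintype ℱ] [Fintype 𝒢] {f : 𝒳 → 𝒴 → ℱ} {g : 𝒳 → 𝒴 → 𝒢}
    (hcond : ∀ u w, (pXY w).toReal * (K w.1 u).toReal ≠ 0 →
        mass (fun w => (pXY w).toReal * (K w.1 u).toReal)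
            (fun w => (g w.1 w.2, f w.1 w.2, w.2)) (g w.1 w.2, f w.1 w.2, w.2) =
          condProb (fun w => (pXY w).toReal) (fun w => g w.1 w.2) (fun w => (f w.1 w.2, w.2))
              (g w.1 w.2) (f w.1 w.2, w.2) *
            mass (fun w => (pXY w).toReal * (K w.1 u).toReal) (fun w => (f w.1 w.2, w.2))
              (f w.1 w.2, w.2)) (n : ℕ) :
    condMutualInfo (copyLaw pXY K n) (fun c => c.2) (fun c i => g (c.1 i).1 (c.1 i).2)
      (fun c => (fun i => f (c.1 i).1 (c.1 i).2, fun i => (c.1 i).2)) = 0 := by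
  have hp0 : ∀ w, 0 ≤ (pXY w).toReal := fun w => ENNReal.toReal_nonneg
  set Q : 𝒳 × 𝒴 → ℝ := fun w => condProb (fun w => (pXY w).toReal) (fun w => g w.1 w.2)
    (fun w => (f w.1 w.2, w.2)) (g w.1 w.2) (f w.1 w.2, w.2) with hQ
  have h1 := hasSum_condMutualInfo (copyLaw pXY K n) (fun c => c.2) (fun c => c.1)
    (fun w i => g (w i).1 (w i).2)
    (fun w => (fun i => f (w i).1 (w i).2, fun i => (w i).2))
  have h5 : ∀ m : Fin n → 𝒰, finEntropy (fun w : Fin n → 𝒳 × 𝒴 =>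
        ∏ i, (pXY (w i)).toReal * (K (w i).1 (m i)).toReal) (fun w i => g (w i).1 (w i).2)
        (fun w => (fun i => f (w i).1 (w i).2, fun i => (w i).2)) =
      ∑ w : Fin n → 𝒳 × 𝒴, (∏ i, (pXY (w i)).toReal * (K (w i).1 (m i)).toReal) *
        ∑ i, -Real.log (Q (w i)) := fun m => by
    rw [finEntropy_pair_pi _ (fun w => g w.1 w.2) (fun w => f w.1 w.2) Prod.snd]
    exact finEntropy_prod (v := fun i w => (pXY w).toReal * (K w.1 (m i)).toReal)
      (fun i w => mul_nonneg (hp0 w) ENNReal.toReal_nonneg) (fun w => g w.1 w.2)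
      (fun w => (f w.1 w.2, w.2)) Q fun i w hw => hcond (m i) w hw
  have h6 : finEntropy (fun w : Fin n → 𝒳 × 𝒴 => ∏ i, (pXY (w i)).toReal)
        (fun w i => g (w i).1 (w i).2) (fun w => (fun i => f (w i).1 (w i).2, fun i => (w i).2)) =
      ∑ w : Fin n → 𝒳 × 𝒴, (∏ i, (pXY (w i)).toReal) * ∑ i, -Real.log (Q (w i)) := by
    rw [finEntropy_pair_pi _ (fun w => g w.1 w.2) (fun w => f w.1 w.2) Prod.snd]
    refine finEntropy_prod (v := fun _ w => (pXY w).toReal) (fun _ => hp0) (fun w => g w.1 w.2)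
      (fun w => (f w.1 w.2, w.2)) Q fun _ w hw => ?_
    exact (div_mul_cancel₀ _ (mass_pos hp0 (fun w => (f w.1 w.2, w.2)) hw).ne').symm
  have h7 := hasSum_sum_prob_mul (copyLaw pXY K n) (fun c => c.2) (fun c => c.1)
    fun w => ∑ i, -Real.log (Q (w i))
  simp only [prob_copyLaw, prob_copyLaw_fst] at h1 h7
  simp only [h5, h6] at h1
  have h8 := h1.unique h7
  linarith

end Copy

/-- Alice sends `n` independent copies of `U`, from which Bob computes `F^n` without error. The
conditional independence of `U` and `G` given `(F, Y)`, read off from the equality case of Gibbs'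
inequality, is inherited by the product, so nothing leaks. -/
theorem asymptoticallySecurelyComputable_of_perfectly [Fintype ℱ] [Fintype 𝒢]
    {pXY : PMF (𝒳 × 𝒴)} {f : 𝒳 → 𝒴 → ℱ} {g : 𝒳 → 𝒴 → 𝒢} (h : PerfectlySecurelyComputable pXY f g) :
    AsymptoticallySecurelyComputable pXY f g := by
  obtain ⟨𝒰, _, K, dec, hdec, hcond⟩ := h.exists_kernel
  refine ⟨copyProtocol K dec, fun ε hε => ⟨0, fun n _ => ?_⟩⟩
  have herr : (copyProtocol K dec n).errorProb pXY f = 0 := by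
    rw [Protocol.errorProb, law_copyProtocol pXY K hdec, PMF.toOuterMeasure_map_apply]
    simp
  have hleak : (copyProtocol K dec n).leakage pXY g = 0 := by
    rw [Protocol.leakage, law_copyProtocol pXY K hdec, condMutualInfo_map]
    exact condMutualInfo_copyLaw pXY K hcond n
  rw [herr, hleak]
  exact ⟨hε.le, by positivity⟩

end Achievability

/-! ### Entropy bounds for blocks -/

section Block

variable {S W Z α β γ ℱ : Type*} [Fintype S] [Fintype W] [Fintype Z] {n : ℕ}

lemma mass_fst_mul (a : W → ℝ) {b : W → Z → ℝ}
    (hb1 : ∀ w, ∑ z, b w z = 1) : mass (fun s : W × Z => a s.1 * b s.1 s.2) Prod.fst = a := by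
  classical
  funext w
  simp only [mass]
  rw [Fintype.sum_prod_type, Finset.sum_eq_single w (fun w' _ hw' => by simp [hw']) (by simp)]
  simp [← Finset.mul_sum, hb1]

lemma mass_comp_fst_mul {δ : Type*} (a : W → ℝ) {b : W → Z → ℝ} (hb1 : ∀ w, ∑ z, b w z = 1)
    (D : W → δ) (d : δ) :
    mass (fun s : W × Z => a s.1 * b s.1 s.2) (fun s => D s.1) d = mass a D d := by
  rw [← mass_mass _ Prod.fst D, mass_fst_mul a hb1]

/-- If `Z` is drawn from a kernel that depends on `Y` only, then it gives no further information on
the other variables. -/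
lemma finEntropy_fst_eq_of_kernel {a : W → ℝ} (ha : ∀ w, 0 ≤ a w) (A : W → α) (Y : W → β)
    {b : β → Z → ℝ} (hb1 : ∀ y, ∑ z, b y z = 1) :
    finEntropy (fun s : W × Z => a s.1 * b (Y s.1) s.2) (fun s => A s.1) (fun s => Y s.1) =
      finEntropy (fun s : W × Z => a s.1 * b (Y s.1) s.2) (fun s => A s.1)
        fun s => (Y s.1, s.2) := by
  classical
  have h2 : ∀ y z, mass (fun s : W × Z => a s.1 * b (Y s.1) s.2) (fun s => (Y s.1, s.2)) (y, z) =
      mass a Y y * b y z := fun y z => by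
    simp only [mass, Finset.sum_mul]
    rw [Fintype.sum_prod_type]
    refine Finset.sum_congr rfl fun w _ => ?_
    by_cases h : Y w = y <;> simp [h]
  have h3 : ∀ c y z, mass (fun s : W × Z => a s.1 * b (Y s.1) s.2)
      (fun s => (A s.1, Y s.1, s.2)) (c, y, z) = mass a (fun w => (A w, Y w)) (c, y) * b y z :=
    fun c y z => by
      simp only [mass, Finset.sum_mul]
      rw [Fintype.sum_prod_type]
      refine Finset.sum_congr rfl fun w _ => ?_
      by_cases h : Y w = y <;> by_cases h' : A w = c <;> simp [h, h']
  refine Finset.sum_congr rfl fun s _ => ?_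
  by_cases hs : a s.1 * b (Y s.1) s.2 = 0
  · simp [hs]
  · have ha0 := left_ne_zero_of_mul hs
    have hb0 := right_ne_zero_of_mul hs
    have hb1' : ∀ w, ∑ z, b (Y w) z = 1 := fun w => hb1 _
    rw [mass_comp_fst_mul a hb1' Y, mass_comp_fst_mul a hb1' (fun w => (A w, Y w)), h2, h3,
      Real.log_mul (mass_pos ha Y ha0).ne' hb0,
      Real.log_mul (mass_pos ha (fun w => (A w, Y w)) ha0).ne' hb0]
    ring

variable [Fintype α] [Fintype β] [Fintype γ] [Fintype ℱ]

/-- A conditional code, linear in the error indicator, for a variable that is almost determined by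
another one. This takes the place of Fano's inequality; its linearity lets it be summed over the
values of the message. -/
lemma exists_fano_code (ℱ : Type*) [Fintype ℱ] [DecidableEq ℱ] {η : ℝ} (hη : 0 < η) :
    ∃ C : ℝ, 0 ≤ C ∧ ∃ Q : ℱ → ℱ → ℝ, (∀ a b, 0 < Q a b) ∧ (∀ b, ∑ a, Q a b ≤ 1) ∧
      ∀ a b, -Real.log (Q a b) ≤ η + C * if a ≠ b then 1 else 0 := by
  rcases isEmpty_or_nonempty ℱ with h | h
  · exact ⟨0, le_rfl, fun _ _ => 1, fun _ _ => one_pos, fun b => h.elim b, fun a => h.elim a⟩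
  set k : ℝ := ((Fintype.card ℱ : ℕ) : ℝ) with hk
  have hk1 : 1 ≤ k := by
    rw [hk]
    exact_mod_cast Nat.succ_le_of_lt (Fintype.card_pos (α := ℱ))
  have hk0 : 0 < k := by linarith
  have he : Real.exp (-η) < 1 := by simpa using hη
  set δ := (1 - Real.exp (-η)) / k with hδ
  have hδ0 : 0 < δ := div_pos (by linarith) hk0
  have hδ1 : δ ≤ 1 := (div_le_one hk0).2 (by linarith [Real.exp_pos (-η)])
  have hlog : Real.log δ ≤ 0 := Real.log_nonpos hδ0.le hδ1
  refine ⟨-Real.log δ, by linarith, fun a b => δ + if a = b then Real.exp (-η) else 0,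
    fun a b => ?_, fun b => ?_, fun a b => ?_⟩
  · have := Real.exp_pos (-η)
    by_cases h : a = b <;> simp only [h, if_true, if_false] <;> linarith
  · rw [Finset.sum_add_distrib]
    simp only [Finset.sum_const, Finset.card_univ, nsmul_eq_mul, Finset.sum_ite_eq',
      Finset.mem_univ, if_true]
    rw [← hk, hδ, mul_div_cancel₀ _ hk0.ne']
    linarith
  · by_cases hab : a = b
    · have : Real.log (Real.exp (-η)) ≤ Real.log (δ + Real.exp (-η)) :=
        Real.log_le_log (Real.exp_pos _) (by linarith)
      rw [Real.log_exp] at this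
      simp only [hab, if_true, ne_eq, not_true_eq_false, if_false, mul_zero, add_zero]
      linarith
    · simp only [hab, if_false, add_zero, ne_eq, not_false_eq_true, if_true, mul_one]
      linarith

/-- Replacing `F` by an estimate `Z` in the condition costs at most `H(Z | F)`, here bounded by the
length of a product code for `Z` given `F`. -/
lemma finEntropy_le_add_code {v : S → ℝ} (hv : ∀ s, 0 ≤ v s) (G : S → γ) (Y : S → β)
    (F Z : S → Fin n → ℱ) {Q : ℱ → ℱ → ℝ} (hQ : ∀ a b, 0 < Q a b) (hQ1 : ∀ b, ∑ a, Q a b ≤ 1) :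
    finEntropy v G (fun s => (F s, Y s)) ≤ finEntropy v G (fun s => (Z s, Y s)) +
      ∑ s, v s * ∑ i, -Real.log (Q (Z s i) (F s i)) := by
  classical
  refine (finEntropy_mono_left hv (fun s => (G s, Z s)) (fun s => (F s, Y s)) Prod.fst).trans ?_
  have hcp : ∀ s, v s ≠ 0 → 0 < condProb v G (fun s => (Z s, Y s)) (G s) (Z s, Y s) :=
    fun s hs => condProb_pos hv G (fun s => (Z s, Y s)) hs
  have hprod : ∀ z f : Fin n → ℱ, 0 < ∏ i, Q (z i) (f i) := fun z f =>
    Finset.prod_pos fun i _ => hQ _ _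
  refine (finEntropy_le (A := fun s => (G s, Z s)) (B := fun s => (F s, Y s))
    (Q := fun a b => condProb v G (fun s => (Z s, Y s)) a.1 (a.2, b.2) *
      ∏ i, Q (a.2 i) (b.1 i)) hv
    (fun a b => mul_nonneg (condProb_nonneg hv _ _ _ _) (hprod _ _).le) (fun b => ?_)
    fun s hs => mul_pos (hcp s hs) (hprod _ _)).trans_eq ?_
  · rw [Fintype.sum_prod_type_right]
    simp only [← Finset.sum_mul]
    calc _ ≤ ∑ z : Fin n → ℱ, ∏ i, Q (z i) (b.1 i) := Finset.sum_le_sum fun z _ =>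
          mul_le_of_le_one_left (hprod _ _).le (sum_condProb_le_one _ _ _ _)
      _ = ∏ i, ∑ a, Q a (b.1 i) := by
          rw [Finset.prod_univ_sum, Fintype.piFinset_univ]
      _ ≤ 1 := Finset.prod_le_one (fun i _ => Finset.sum_nonneg fun a _ => (hQ _ _).le)
          fun i _ => hQ1 _
  · rw [finEntropy_eq hv G, ← Finset.sum_add_distrib]
    refine Finset.sum_congr rfl fun s _ => ?_
    by_cases hs : v s = 0
    · simp [hs]
    · rw [Real.log_mul (hcp s hs).ne' (hprod _ _).ne', Real.log_prod fun i _ => (hQ _ _).ne',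
        Finset.sum_neg_distrib]
      ring

/-- Subadditivity over the block, after adjoining `F_i` to each `G_i`. -/
lemma finEntropy_block_le {v : S → ℝ} (hv : ∀ s, 0 ≤ v s) (G : S → Fin n → γ)
    (F : S → Fin n → α) (B : S → β) {δ : Type*} (φ : β → δ) :
    finEntropy v G B ≤ ∑ i, (finEntropy v (fun s => F s i) (fun s => φ (B s)) +
      finEntropy v (fun s => G s i) fun s => (F s i, φ (B s))) := by
  classical
  refine (finEntropy_mono_left hv (fun s => (G s, F s)) B Prod.fst).trans ?_
  set q : Fin n → γ → α → δ → ℝ := fun i c a d =>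
    condProb v (fun s => F s i) (fun s => φ (B s)) a d *
      condProb v (fun s => G s i) (fun s => (F s i, φ (B s))) c (a, d) with hq
  have hq0 : ∀ i c a d, 0 ≤ q i c a d := fun i c a d =>
    mul_nonneg (condProb_nonneg hv _ _ _ _) (condProb_nonneg hv _ _ _ _)
  have hF : ∀ i s, v s ≠ 0 →
      0 < condProb v (fun s => F s i) (fun s => φ (B s)) (F s i) (φ (B s)) := fun i s hs =>
    condProb_pos hv (fun s => F s i) (fun s => φ (B s)) hs
  have hG : ∀ i s, v s ≠ 0 → 0 < condProb v (fun s => G s i) (fun s => (F s i, φ (B s))) (G s i)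
      (F s i, φ (B s)) := fun i s hs =>
    condProb_pos hv (fun s => G s i) (fun s => (F s i, φ (B s))) hs
  refine (finEntropy_le (A := fun s => (G s, F s)) (B := B)
    (Q := fun a b => ∏ i, q i (a.1 i) (a.2 i) (φ b)) hv
    (fun a b => Finset.prod_nonneg fun i _ => hq0 _ _ _ _) (fun b => ?_)
    fun s hs => Finset.prod_pos fun i _ => mul_pos (hF i s hs) (hG i s hs)).trans_eq ?_
  · calc _ = ∏ i, ∑ a, ∑ c, q i c a (φ b) := by
          rw [Fintype.sum_prod_type_right, Finset.prod_univ_sum, Fintype.piFinset_univ]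
          refine Finset.sum_congr rfl fun a _ => ?_
          rw [Finset.prod_univ_sum, Fintype.piFinset_univ]
      _ ≤ 1 := Finset.prod_le_one (fun i _ => Finset.sum_nonneg fun a _ =>
          Finset.sum_nonneg fun c _ => hq0 _ _ _ _) fun i _ => by
            simp only [hq, ← Finset.mul_sum]
            exact (Finset.sum_le_sum fun a _ => mul_le_of_le_one_right
              (condProb_nonneg hv _ _ _ _) (sum_condProb_le_one _ _ _ _)).trans
              (sum_condProb_le_one _ _ _ _)
  · simp only [finEntropy_eq hv (fun s => F s _), finEntropy_eq hv (fun s => G s _),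
      ← Finset.sum_add_distrib]
    rw [Finset.sum_comm]
    refine Finset.sum_congr rfl fun s _ => ?_
    by_cases hs : v s = 0
    · simp [hs]
    · rw [Real.log_prod fun i _ => (mul_pos (hF i s hs) (hG i s hs)).ne',
        ← Finset.sum_neg_distrib, Finset.mul_sum]
      refine Finset.sum_congr rfl fun i _ => ?_
      rw [Real.log_mul (hF i s hs).ne' (hG i s hs).ne']
      ring

lemma hasSum_prod_of_nonneg {ι κ : Type*} [Fintype κ] {f : ι × κ → ℝ} (hf : ∀ c, 0 ≤ f c)
    {a : ℝ} (h : HasSum (fun i => ∑ k, f (i, k)) a) : HasSum f a := by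
  have hs : Summable f := (summable_prod_of_nonneg hf).2
    ⟨fun i => Summable.of_finite, by simpa only [tsum_fintype] using h.summable⟩
  have := hs.tsum_prod
  simp only [tsum_fintype, h.tsum_eq] at this
  exact this ▸ hs.hasSum

end Block

/-! ### The single-letter auxiliary variable -/

section SingleLetter

variable {X Y : Type*} [Fintype X] [Fintype Y] {n : ℕ}

/-- The coordinates other than the `i`-th. -/
def others {T : Type*} {n : ℕ} (i : Fin n) (t : Fin n → T) (j : {j // j ≠ i}) : T := t j

lemma eq_extend_of_eq_mul {p μ : X × Y → ℝ} (hp : ∀ w, 0 ≤ p w) {R : X → ℝ}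
    (h : ∀ w, μ w = p w * R w.1) :
    μ = extend p (mass μ Prod.fst) := by
  classical
  have h1 : ∀ x, mass μ Prod.fst x = mass p Prod.fst x * R x := fun x => by
    simp only [mass, Finset.sum_mul, ite_mul, zero_mul, h]
    exact Finset.sum_congr rfl fun w _ => by split_ifs with hw <;> simp [hw]
  funext w
  rw [extend, h1, h]
  by_cases hw : p w = 0
  · simp [hw]
  · field_simp [(mass_pos hp Prod.fst hw).ne']

/-- If `M` is drawn from a kernel that depends on `X^n` only, then `(M, Y^{≠ i}) - X_i - Y_i`: for
fixed values of `M` and of the other `Y_j`, the joint law of `(X_i, Y_i)` is `p_{Y | X}` applied to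
the law of `X_i`. -/
lemma slice_eq_extend {p : X × Y → ℝ} (hp : ∀ w, 0 ≤ p w) (a : (Fin n → X) → ℝ) (i : Fin n)
    (y : {j // j ≠ i} → Y) :
    (fun t => mass (fun w : Fin n → X × Y => (∏ j, p (w j)) * a fun j => (w j).1)
      (fun w => (w i, others i fun j => (w j).2)) (t, y)) =
    extend p (mass (fun t => mass (fun w : Fin n → X × Y => (∏ j, p (w j)) * a fun j => (w j).1)
      (fun w => (w i, others i fun j => (w j).2)) (t, y)) Prod.fst) := by
  classical
  refine eq_extend_of_eq_mul hp (R := fun x => ∑ w' : {j // j ≠ i} → X × Y,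
    if (fun j => (w' j).2) = y then (∏ j, p (w' j)) *
      a (fun j => if h : j = i then x else (w' ⟨j, h⟩).1) else 0) fun t => ?_
  rw [mass, ← (Equiv.funSplitAt i (X × Y)).symm.sum_comp, Fintype.sum_prod_type,
    Finset.mul_sum]
  refine (Finset.sum_eq_single t (fun t' _ ht' => Finset.sum_eq_zero fun w' _ => if_neg ?_)
    (by simp)).trans ?_
  · simp [ht']
  · refine Finset.sum_congr rfl fun w' _ => ?_
    have h1 : (Equiv.funSplitAt i (X × Y)).symm (t, w') i = t := by simp
    have h2 : ∀ j : {j // j ≠ i}, (Equiv.funSplitAt i (X × Y)).symm (t, w') j = w' j := fun j => by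
      simp [j.2]
    have h3 : (others i fun j => ((Equiv.funSplitAt i (X × Y)).symm (t, w') j).2) =
        fun j => (w' j).2 := funext fun j => by rw [others, h2]
    have h4 : (fun j => ((Equiv.funSplitAt i (X × Y)).symm (t, w') j).1) =
        fun j => if h : j = i then t.1 else (w' ⟨j, h⟩).1 := funext fun j => by
      by_cases h : j = i
      · subst h; simp
      · simp [h]
    have h5 : ∏ j, p ((Equiv.funSplitAt i (X × Y)).symm (t, w') j) = p t * ∏ j, p (w' j) := by
      rw [Fintype.prod_eq_mul_prod_compl i, h1,
        Finset.prod_subtype (p := fun j => j ≠ i) ({i}ᶜ : Finset (Fin n)) (by simp)]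
      congr 1
      exact Finset.prod_congr rfl fun j _ => by rw [h2]
    rw [h1, h3, h4, h5]
    by_cases h : (fun j => (w' j).2) = y <;> simp [h, mul_assoc]

end SingleLetter

/-! ### From asymptotic to perfect security -/

section Converse

variable {𝒳 𝒴 ℱ 𝒢 : Type*} [Fintype 𝒳] [Fintype 𝒴] {n : ℕ}

lemma Protocol.law_apply_toReal (π : Protocol 𝒳 𝒴 ℱ n) (pXY : PMF (𝒳 × 𝒴))
    (w : Fin n → 𝒳 × 𝒴) (m : π.Msg) (z : Fin n → ℱ) :
    (π.law pXY (w, m, z)).toReal = (∏ i, (pXY (w i)).toReal) *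
      (π.alice (fun i => (w i).1) m).toReal * (π.bob m (fun i => (w i).2) z).toReal := by
  have h : π.law pXY = (iid pXY n).bind fun w =>
      ((π.alice fun i => (w i).1).bind fun m =>
        (π.bob m fun i => (w i).2).map fun z => (m, z)).map fun c => (w, c) := by
    simp only [Protocol.law, PMF.map_bind, PMF.map_comp]
    rfl
  rw [h, bind_map_mk_apply (iid pXY n) (fun w => (π.alice fun i => (w i).1).bind fun m =>
      (π.bob m fun i => (w i).2).map fun z => (m, z)),
    bind_map_mk_apply (π.alice fun i => (w i).1) (fun m => π.bob m fun i => (w i).2),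
    ENNReal.toReal_mul, ENNReal.toReal_mul, iid_apply_toReal, mul_assoc]

lemma Protocol.prob_law (π : Protocol 𝒳 𝒴 ℱ n) (pXY : PMF (𝒳 × 𝒴)) (m : π.Msg)
    (s : (Fin n → 𝒳 × 𝒴) × (Fin n → ℱ)) :
    prob (π.law pXY) (fun ω => (ω.2.1, (ω.1, ω.2.2))) (m, s) = (∏ i, (pXY (s.1 i)).toReal) *
      (π.alice (fun i => (s.1 i).1) m).toReal * (π.bob m (fun i => (s.1 i).2) s.2).toReal := by
  rw [← π.law_apply_toReal]
  refine prob_of_injective (π.law pXY) (E := fun ω => (ω.2.1, (ω.1, ω.2.2))) ?_ (s.1, m, s.2)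
  rintro ⟨w, m, z⟩ ⟨w', m', z'⟩ h
  simp only [Prod.mk.injEq] at h ⊢
  exact ⟨h.2.1, h.1, h.2.2⟩

lemma Protocol.prob_law_fst (π : Protocol 𝒳 𝒴 ℱ n) (pXY : PMF (𝒳 × 𝒴)) :
    prob (π.law pXY) (fun ω => ω.1) = fun w => ∏ i, (pXY (w i)).toReal := by
  funext w
  have : (π.law pXY).map (fun ω => ω.1) = iid pXY n := by
    simp [Protocol.law, PMF.map, Function.comp_def]
  rw [prob, this, iid_apply_toReal]

lemma summable_finEntropy {S ι α β : Type*} [Fintype S] [Fintype α] [Fintype β] {v : ι → S → ℝ}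
    (hv : ∀ u s, 0 ≤ v u s) (hs : ∀ s, Summable fun u => v u s) (A : S → α) (B : S → β) :
    Summable fun u => finEntropy (v u) A B :=
  Summable.of_nonneg_of_le (fun u => finEntropy_nonneg (hv u) A B)
    (fun u => finEntropy_le_log_card (hv u) A B)
    (summable_sum fun s _ => (hs s).mul_right (Real.log (Fintype.card α)))

/-- For one position `i` of a block, the variable `U = (M, Y^{≠ i})` decomposes the law of `X_i`,
with `H(F | U, Y) = H(F_i | M, Y^n)` and `H(G | U, F, Y) = H(G_i | M, F_i, Y^n)`. -/
lemma exists_decomposition_of_coord.{v} {M : Type} {𝒳 : Type*} {𝒴 : Type v} [Fintype 𝒳] [Fintype 𝒴]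
    {p : 𝒳 × 𝒴 → ℝ} (hp0 : ∀ w, 0 ≤ p w) (hp1 : ∑ w, p w = 1) (f : 𝒳 → 𝒴 → ℱ) (g : 𝒳 → 𝒴 → 𝒢)
    {q : M → (Fin n → 𝒳) → ℝ} (hq : ∀ m x, 0 ≤ q m x) (hq1 : ∀ x, HasSum (fun m => q m x) 1)
    {A B : ℝ} (i : Fin n)
    (hA : HasSum (fun m => finEntropy (fun w : Fin n → 𝒳 × 𝒴 =>
      (∏ j, p (w j)) * q m fun j => (w j).1) (fun w => f (w i).1 (w i).2) fun w j => (w j).2) A)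
    (hB : HasSum (fun m => finEntropy (fun w : Fin n → 𝒳 × 𝒴 =>
      (∏ j, p (w j)) * q m fun j => (w j).1) (fun w => g (w i).1 (w i).2)
        fun w => (f (w i).1 (w i).2, fun j => (w j).2)) B) :
    ∃ (ι : Type v) (r : ι → 𝒳 → ℝ), (∀ u x, 0 ≤ r u x) ∧
      (∀ x, HasSum (fun u => r u x) (mass p Prod.fst x)) ∧
      HasSum (fun u => finEntropy (extend p (r u)) (fun w => f w.1 w.2) Prod.snd) A ∧
      HasSum (fun u => finEntropy (extend p (r u)) (fun w => g w.1 w.2)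
        fun w => (f w.1 w.2, w.2)) B := by
  classical
  set a : M → (Fin n → 𝒳 × 𝒴) → ℝ := fun m w => (∏ j, p (w j)) * q m fun j => (w j).1 with ha
  have ha0 : ∀ m w, 0 ≤ a m w := fun m w =>
    mul_nonneg (Finset.prod_nonneg fun i _ => hp0 _) (hq _ _)
  have has : ∀ w, HasSum (fun m => a m w) (∏ j, p (w j)) := fun w => by
    simpa using (hq1 fun j => (w j).1).mul_left (∏ j, p (w j))
  set μ : M × ({j // j ≠ i} → 𝒴) → 𝒳 × 𝒴 → ℝ := fun u t =>
    mass (a u.1) (fun w => (w i, others i fun j => (w j).2)) (t, u.2) with hμ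
  have hμ0 : ∀ u t, 0 ≤ μ u t := fun u t => mass_nonneg (ha0 _) _ _
  have hμext : ∀ u, μ u = extend p (mass (μ u) Prod.fst) := fun u =>
    slice_eq_extend hp0 (q u.1) i u.2
  have hsplit : ∀ w w' : Fin n → 𝒳 × 𝒴, ((fun j => (w j).2) = fun j => (w' j).2) ↔
      (w i).2 = (w' i).2 ∧
        (others i fun j => (w j).2) = others i fun j => (w' j).2 := fun w w' => by
    constructor
    · intro h
      exact ⟨congrFun h i, by rw [h]⟩
    · rintro ⟨h1, h2⟩
      funext j
      by_cases hj : j = i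
      · rw [hj]; exact h1
      · exact congrFun h2 ⟨j, hj⟩
  have hAμ : ∀ m, finEntropy (a m) (fun w => f (w i).1 (w i).2) (fun w j => (w j).2) =
      ∑ y, finEntropy (μ (m, y)) (fun w => f w.1 w.2) Prod.snd := fun m => by
    rw [← finEntropy_prod_right (a m) (fun w => w i) (fun w => others i fun j => (w j).2)
      (fun w => f w.1 w.2) Prod.snd]
    exact finEntropy_congr (fun _ _ _ _ => Iff.rfl) fun w w' _ _ => by
      rw [hsplit, Prod.mk.injEq]
  have hBμ : ∀ m, finEntropy (a m) (fun w => g (w i).1 (w i).2)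
        (fun w => (f (w i).1 (w i).2, fun j => (w j).2)) =
      ∑ y, finEntropy (μ (m, y)) (fun w => g w.1 w.2) fun w => (f w.1 w.2, w.2) := fun m => by
    rw [← finEntropy_prod_right (a m) (fun w => w i) (fun w => others i fun j => (w j).2)
      (fun w => g w.1 w.2) fun w => (f w.1 w.2, w.2)]
    exact finEntropy_congr (fun _ _ _ _ => Iff.rfl) fun w w' _ _ => by
      simp only [Prod.mk.injEq, hsplit, and_assoc]
  refine ⟨M × ({j // j ≠ i} → 𝒴), fun u => mass (μ u) Prod.fst,
    fun u x => mass_nonneg (hμ0 u) _ _, fun x => ?_, ?_, ?_⟩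
  · refine hasSum_prod_of_nonneg (fun u => mass_nonneg (hμ0 u) _ _) ?_
    have h1 : ∀ m, ∑ y, mass (μ (m, y)) Prod.fst x = mass (a m) (fun w => (w i).1) x := fun m => by
      rw [← sum_mass_pair (a m) (fun w => others i fun j => (w j).2) fun w => (w i).1]
      refine Finset.sum_congr rfl fun y _ => ?_
      rw [mass_slice]
      exact mass_congr fun w _ => by simp [and_comm]
    have h2 : mass (fun w : Fin n → 𝒳 × 𝒴 => ∏ j, p (w j)) (fun w => (w i).1) x =
        mass p Prod.fst x := by
      have := sum_prod_mul_apply hp1 i fun t => if t.1 = x then (1 : ℝ) else 0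
      simpa [mass] using this
    simp only [h1]
    rw [← h2]
    refine hasSum_sum fun w _ => ?_
    split_ifs
    exacts [has w, hasSum_zero]
  · simp only [← hμext]
    refine hasSum_prod_of_nonneg (fun u => finEntropy_nonneg (hμ0 u) _ _) ?_
    simpa only [← hAμ] using hA
  · simp only [← hμext]
    refine hasSum_prod_of_nonneg (fun u => finEntropy_nonneg (hμ0 u) _ _) ?_
    simpa only [← hBμ] using hB

variable [Fintype ℱ] [Fintype 𝒢]

/-- `H(G^n | F^n, Y^n)` is additive over the block, and exceeds `H(G^n | Z^n, Y^n)` by no more than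
the length of a code for `Z^n` given `F^n`. -/
lemma mul_finEntropy_le_block [DecidableEq ℱ] {p : 𝒳 × 𝒴 → ℝ} (hp0 : ∀ w, 0 ≤ p w)
    (hp1 : ∑ w, p w = 1) (f : 𝒳 → 𝒴 → ℱ) (g : 𝒳 → 𝒴 → 𝒢)
    {V : (Fin n → 𝒳 × 𝒴) × (Fin n → ℱ) → ℝ} (hV0 : ∀ s, 0 ≤ V s)
    (hV : mass V Prod.fst = fun w => ∏ i, p (w i)) {Q : ℱ → ℱ → ℝ} (hQ : ∀ a b, 0 < Q a b)
    (hQ1 : ∀ b, ∑ a, Q a b ≤ 1) {c : (Fin n → 𝒳 × 𝒴) × (Fin n → ℱ) → ℝ}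
    (hc : ∀ s i, -Real.log (Q (s.2 i) (f (s.1 i).1 (s.1 i).2)) ≤ c s) :
    n * finEntropy p (fun w => g w.1 w.2) (fun w => (f w.1 w.2, w.2)) ≤
      finEntropy V (fun s i => g (s.1 i).1 (s.1 i).2) (fun s => (s.2, fun i => (s.1 i).2)) +
        n * ∑ s, V s * c s := by
  have hiid : finEntropy V (fun s i => g (s.1 i).1 (s.1 i).2)
      (fun s => (fun i => f (s.1 i).1 (s.1 i).2, fun i => (s.1 i).2)) =
      n * finEntropy p (fun w => g w.1 w.2) (fun w => (f w.1 w.2, w.2)) := by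
    rw [← finEntropy_mass V Prod.fst (fun w i => g (w i).1 (w i).2)
      (fun w => (fun i => f (w i).1 (w i).2, fun i => (w i).2)), hV,
      finEntropy_pair_pi _ (fun w => g w.1 w.2) (fun w => f w.1 w.2) Prod.snd]
    exact finEntropy_iid hp0 hp1 (fun w => g w.1 w.2) fun w => (f w.1 w.2, w.2)
  rw [← hiid]
  refine (finEntropy_le_add_code hV0 (fun s i => g (s.1 i).1 (s.1 i).2) (fun s i => (s.1 i).2)
    (fun s i => f (s.1 i).1 (s.1 i).2) Prod.snd hQ hQ1).trans ?_
  gcongr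
  calc _ ≤ ∑ s, V s * ∑ _i : Fin n, c s := Finset.sum_le_sum fun s _ =>
        mul_le_mul_of_nonneg_left (Finset.sum_le_sum fun i _ => hc s i) (hV0 s)
    _ = n * ∑ s, V s * c s := by
        rw [Finset.mul_sum]
        refine Finset.sum_congr rfl fun s _ => ?_
        rw [Finset.sum_const, Finset.card_univ, Fintype.card_fin, nsmul_eq_mul]
        ring

/-- As `Z^n` is drawn from `Y^n` alone once the message is fixed, `F_i` is as uncertain given `Y^n`
as it is given `(Y^n, Z^n)`, and so is coded well with the help of `Z_i`. -/
lemma finEntropy_coord_le {a : (Fin n → 𝒳 × 𝒴) → ℝ} (ha : ∀ w, 0 ≤ a w)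
    {b : (Fin n → 𝒴) → (Fin n → ℱ) → ℝ} (hb : ∀ y z, 0 ≤ b y z) (hb1 : ∀ y, ∑ z, b y z = 1)
    (f : 𝒳 → 𝒴 → ℱ) {Q : ℱ → ℱ → ℝ} (hQ : ∀ a b, 0 < Q a b)
    (hQ1 : ∀ b, ∑ a, Q a b ≤ 1) {c : (Fin n → 𝒳 × 𝒴) × (Fin n → ℱ) → ℝ} (i : Fin n)
    (hc : ∀ s, -Real.log (Q (f (s.1 i).1 (s.1 i).2) (s.2 i)) ≤ c s) :
    finEntropy (fun s : (Fin n → 𝒳 × 𝒴) × (Fin n → ℱ) => a s.1 * b (fun j => (s.1 j).2) s.2)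
        (fun s => f (s.1 i).1 (s.1 i).2) (fun s j => (s.1 j).2) ≤
      ∑ s : (Fin n → 𝒳 × 𝒴) × (Fin n → ℱ), a s.1 * b (fun j => (s.1 j).2) s.2 * c s := by
  set v : (Fin n → 𝒳 × 𝒴) × (Fin n → ℱ) → ℝ :=
    fun s => a s.1 * b (fun j => (s.1 j).2) s.2 with hv
  have hv0 : ∀ s, 0 ≤ v s := fun s => mul_nonneg (ha _) (hb _ _)
  have h1 : finEntropy v (fun s => f (s.1 i).1 (s.1 i).2) (fun s j => (s.1 j).2) =
      finEntropy v (fun s => f (s.1 i).1 (s.1 i).2) fun s => (fun j => (s.1 j).2, s.2) :=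
    finEntropy_fst_eq_of_kernel ha (fun w => f (w i).1 (w i).2) (fun w j => (w j).2) hb1
  have h2 : finEntropy v (fun s => f (s.1 i).1 (s.1 i).2) (fun s => (fun j => (s.1 j).2, s.2)) ≤
      finEntropy v (fun s => f (s.1 i).1 (s.1 i).2) fun s => s.2 i :=
    finEntropy_anti_right hv0 _ (fun s => ((fun j => (s.1 j).2 : Fin n → 𝒴), s.2)) fun c => c.2 i
  have h3 : finEntropy v (fun s => f (s.1 i).1 (s.1 i).2) (fun s => s.2 i) ≤
      ∑ s, v s * -Real.log (Q (f (s.1 i).1 (s.1 i).2) (s.2 i)) :=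
    finEntropy_le hv0 (fun a b => (hQ a b).le) hQ1 fun s _ => hQ _ _
  refine (h1.trans_le (h2.trans h3)).trans ?_
  exact Finset.sum_le_sum fun s _ => mul_le_mul_of_nonneg_left (hc s) (hv0 s)

/-- The estimates of the converse for one block. With a code whose redundancy is `η` without errors
and grows with slope `C` in the error probability, some position `i` of the block carries an
auxiliary variable `U = (M, Y^{≠ i})` for which `H(F | U, Y)` and `I(U ; G | F, Y)` are small. -/
lemma exists_decomposition_of_protocol.{v} {𝒳 : Type*} {𝒴 : Type v} [Fintype 𝒳] [Fintype 𝒴]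
    [DecidableEq ℱ] (hn : 0 < n)
    (π : Protocol 𝒳 𝒴 ℱ n) (pXY : PMF (𝒳 × 𝒴)) (f : 𝒳 → 𝒴 → ℱ) (g : 𝒳 → 𝒴 → 𝒢) {η C ε : ℝ}
    (hC : 0 ≤ C) {Q : ℱ → ℱ → ℝ} (hQ : ∀ a b, 0 < Q a b) (hQ1 : ∀ b, ∑ a, Q a b ≤ 1)
    (hQC : ∀ a b, -Real.log (Q a b) ≤ η + C * if a ≠ b then 1 else 0)
    (herr : π.errorProb pXY f ≤ ε) (hleak : π.leakage pXY g ≤ n * ε) :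
    ∃ (ι : Type v) (r : ι → 𝒳 → ℝ) (a b : ℝ), (∀ u x, 0 ≤ r u x) ∧
      (∀ x, HasSum (fun u => r u x) (mass (fun w => (pXY w).toReal) Prod.fst x)) ∧
      HasSum (fun u => finEntropy (extend (fun w => (pXY w).toReal) (r u))
        (fun w => f w.1 w.2) Prod.snd) a ∧
      HasSum (fun u => finEntropy (extend (fun w => (pXY w).toReal) (r u))
        (fun w => g w.1 w.2) fun w => (f w.1 w.2, w.2)) b ∧
      a ≤ η + C * ε ∧
      finEntropy (fun w => (pXY w).toReal) (fun w => g w.1 w.2) (fun w => (f w.1 w.2, w.2)) -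
        (ε + 2 * (η + C * ε)) ≤ b := by
  classical
  set p : 𝒳 × 𝒴 → ℝ := fun w => (pXY w).toReal with hp
  have hp0 : ∀ w, 0 ≤ p w := fun w => ENNReal.toReal_nonneg
  have hp1 : ∑ w, p w = 1 := sum_toReal_pmf pXY
  -- `V` is the joint law of `(X^n, Y^n)` and `Z^n`; its part with `M = m` is `a m * b m`
  set V := prob (π.law pXY) (fun ω => (ω.1, ω.2.2)) with hV
  have hV0 : ∀ s, 0 ≤ V s := prob_nonneg _ _
  have hV1 : ∑ s, V s = 1 := sum_prob _ _
  set q : π.Msg → (Fin n → 𝒳) → ℝ := fun m x => (π.alice x m).toReal with hq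
  have hq1 : ∀ x, HasSum (fun m => q m x) 1 := fun x => by
    have h1 := ENNReal.hasSum_toReal (PMF.tsum_coe_ne_top (π.alice x))
    rwa [← ENNReal.tsum_toReal_eq (PMF.apply_ne_top _), PMF.tsum_coe, ENNReal.toReal_one] at h1
  set a : π.Msg → (Fin n → 𝒳 × 𝒴) → ℝ := fun m w => (∏ i, p (w i)) * q m fun i => (w i).1 with ha
  have ha0 : ∀ m w, 0 ≤ a m w := fun m w =>
    mul_nonneg (Finset.prod_nonneg fun i _ => hp0 _) ENNReal.toReal_nonneg
  set b : π.Msg → (Fin n → 𝒴) → (Fin n → ℱ) → ℝ := fun m y z => (π.bob m y z).toReal with hb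
  have hb0 : ∀ m y z, 0 ≤ b m y z := fun m y z => ENNReal.toReal_nonneg
  have hb1 : ∀ m y, ∑ z, b m y z = 1 := fun m y => sum_toReal_pmf _
  set v : π.Msg → (Fin n → 𝒳 × 𝒴) × (Fin n → ℱ) → ℝ :=
    fun m s => a m s.1 * b m (fun i => (s.1 i).2) s.2 with hv
  have hv0 : ∀ m s, 0 ≤ v m s := fun m s => mul_nonneg (ha0 _ _) (hb0 _ _ _)
  have hprob : ∀ m s, prob (π.law pXY) (fun ω => (ω.2.1, (ω.1, ω.2.2))) (m, s) = v m s :=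
    π.prob_law pXY
  have hvV : ∀ h : (Fin n → 𝒳 × 𝒴) × (Fin n → ℱ) → ℝ,
      HasSum (fun m => ∑ s, v m s * h s) (∑ s, V s * h s) := fun h => by
    simpa only [hprob] using
      hasSum_sum_prob_mul (π.law pXY) (fun ω => ω.2.1) (fun ω => (ω.1, ω.2.2)) h
  have hvs : ∀ s, Summable fun m => v m s := fun s => by
    have h1 := (hasSum_prob (π.law pXY) (fun ω => ω.2.1) (fun ω => (ω.1, ω.2.2)) s).summable
    simpa only [hprob] using h1
  have hL : HasSum (fun m => finEntropy (v m) (fun s i => g (s.1 i).1 (s.1 i).2)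
        fun s => (s.2, fun i => (s.1 i).2))
      (finEntropy V (fun s i => g (s.1 i).1 (s.1 i).2) (fun s => (s.2, fun i => (s.1 i).2)) -
        π.leakage pXY g) := by
    have h1 := hasSum_condMutualInfo (π.law pXY) (fun ω => ω.2.1) (fun ω => (ω.1, ω.2.2))
      (fun s i => g (s.1 i).1 (s.1 i).2) fun s => (s.2, fun i => (s.1 i).2)
    simp only [hprob] at h1
    exact h1
  have hVfst : mass V Prod.fst = fun w => ∏ i, p (w i) := by
    rw [← π.prob_law_fst]
    funext w
    exact (prob_comp (π.law pXY) (fun ω => (ω.1, ω.2.2)) Prod.fst w).symm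
  -- the code lengths in terms of the indicator `E` of an error
  set E : (Fin n → 𝒳 × 𝒴) × (Fin n → ℱ) → ℝ :=
    fun s => if s.2 ≠ (fun i => f (s.1 i).1 (s.1 i).2) then 1 else 0 with hE
  have hVE : ∑ s, V s * E s ≤ ε :=
    (toReal_toOuterMeasure_comp (π.law pXY) (fun ω => (ω.1, ω.2.2))
      fun s => s.2 ≠ fun i => f (s.1 i).1 (s.1 i).2).symm.trans_le herr
  have hE1 : ∀ s i, (if s.2 i ≠ f (s.1 i).1 (s.1 i).2 then (1 : ℝ) else 0) ≤ E s := fun s i => by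
    by_cases h : s.2 = fun i => f (s.1 i).1 (s.1 i).2
    · simp [hE, h]
    · simp only [hE, ne_eq, h, not_false_eq_true, if_true]
      split_ifs <;> norm_num
  have hcode : ∀ s i, -Real.log (Q (s.2 i) (f (s.1 i).1 (s.1 i).2)) ≤ η + C * E s := fun s i =>
    (hQC _ _).trans (by gcongr; exact hE1 s i)
  have hcode' : ∀ s i, -Real.log (Q (f (s.1 i).1 (s.1 i).2) (s.2 i)) ≤ η + C * E s := fun s i =>
    (hQC _ _).trans (by gcongr; simpa only [ne_comm] using hE1 s i)
  have hVcode : ∑ s, V s * (η + C * E s) ≤ η + C * ε := by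
    simp only [mul_add, Finset.sum_add_distrib, ← Finset.sum_mul, hV1, one_mul]
    have : ∑ s, V s * (C * E s) = C * ∑ s, V s * E s := by
      rw [Finset.mul_sum]
      exact Finset.sum_congr rfl fun s _ => by ring
    rw [this]
    gcongr
  set C0 := finEntropy p (fun w => g w.1 w.2) (fun w => (f w.1 w.2, w.2)) with hC0
  have hblock := mul_finEntropy_le_block hp0 hp1 f g hV0 hVfst hQ hQ1 hcode
  -- the single-letter entropies `H(F_i | M, Y^n)` and `H(G_i | F_i, M, Y^n)`
  obtain ⟨A, hA⟩ : ∃ A : Fin n → ℝ, ∀ i, HasSum (fun m =>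
      finEntropy (v m) (fun s => f (s.1 i).1 (s.1 i).2) fun s j => (s.1 j).2) (A i) :=
    ⟨_, fun i => (summable_finEntropy hv0 hvs (fun s => f (s.1 i).1 (s.1 i).2)
      fun s j => (s.1 j).2).hasSum⟩
  obtain ⟨B, hB⟩ : ∃ B : Fin n → ℝ, ∀ i, HasSum (fun m =>
      finEntropy (v m) (fun s => g (s.1 i).1 (s.1 i).2)
        fun s => (f (s.1 i).1 (s.1 i).2, fun j => (s.1 j).2)) (B i) :=
    ⟨_, fun i => (summable_finEntropy hv0 hvs (fun s => g (s.1 i).1 (s.1 i).2)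
      fun s => (f (s.1 i).1 (s.1 i).2, fun j => (s.1 j).2)).hasSum⟩
  have hAε : ∀ i, A i ≤ η + C * ε := fun i =>
    (hasSum_le (fun m => finEntropy_coord_le (ha0 m) (hb0 m) (hb1 m) f hQ hQ1 i
      fun s => hcode' s i) (hA i) (hvV fun s => η + C * E s)).trans hVcode
  have hsum := hasSum_le (fun m => finEntropy_block_le (hv0 m)
    (fun s i => g (s.1 i).1 (s.1 i).2) (fun s i => f (s.1 i).1 (s.1 i).2)
    (fun s => (s.2, (fun i => (s.1 i).2 : Fin n → 𝒴))) Prod.snd) hL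
    (hasSum_sum fun i _ => (hA i).add (hB i))
  obtain ⟨i, -, hi⟩ : ∃ i ∈ (Finset.univ : Finset (Fin n)), C0 - B i ≤ ε + 2 * (η + C * ε) := by
    have : Nonempty (Fin n) := ⟨⟨0, hn⟩⟩
    refine Finset.exists_le_of_sum_le Finset.univ_nonempty ?_
    have h1 : ∑ i, A i ≤ n * (η + C * ε) := by
      simpa only [Finset.sum_const, Finset.card_univ, Fintype.card_fin, nsmul_eq_mul] using
        Finset.sum_le_sum fun i (_ : i ∈ Finset.univ) => hAε i
    have h2 : n * ∑ s, V s * (η + C * E s) ≤ n * (η + C * ε) := by gcongr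
    rw [Finset.sum_add_distrib] at hsum
    simp only [Finset.sum_sub_distrib, Finset.sum_const, Finset.card_univ, Fintype.card_fin,
      nsmul_eq_mul]
    linarith
  have hva : ∀ m, mass (v m) Prod.fst = a m := fun m =>
    mass_fst_mul (a m) (b := fun w => b m fun i => (w i).2) fun w => hb1 m _
  have hA' : HasSum (fun m => finEntropy (a m) (fun w => f (w i).1 (w i).2)
      fun w j => (w j).2) (A i) := by
    simpa only [← hva, finEntropy_mass] using hA i
  have hB' : HasSum (fun m => finEntropy (a m) (fun w => g (w i).1 (w i).2)
      fun w => (f (w i).1 (w i).2, fun j => (w j).2)) (B i) := by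
    simpa only [← hva, finEntropy_mass] using hB i
  obtain ⟨ι, r, hr, hrs, h1, h2⟩ := exists_decomposition_of_coord hp0 hp1 f g
    (fun _ _ => ENNReal.toReal_nonneg) hq1 i hA' hB'
  exact ⟨ι, r, A i, B i, hr, hrs, h1, h2, hAε i, by linarith⟩

/-- Along the given protocols the single-letter auxiliary variables come arbitrarily close to
perfect security, and by compactness some finite one attains it. -/
theorem perfectlySecurelyComputable_of_asymptotically {pXY : PMF (𝒳 × 𝒴)} {f : 𝒳 → 𝒴 → ℱ}
    {g : 𝒳 → 𝒴 → 𝒢} (h : AsymptoticallySecurelyComputable pXY f g) :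
    PerfectlySecurelyComputable pXY f g := by
  classical
  obtain ⟨π, hπ⟩ := h
  obtain ⟨ι, hι, r, hr, hrs, hF, hG⟩ := exists_finite_decomposition
    (p := fun w => (pXY w).toReal) (fun _ => ENNReal.toReal_nonneg) (sum_toReal_pmf pXY)
    (fun w => f w.1 w.2) (fun w => g w.1 w.2) fun δ hδ => by
      obtain ⟨C, hC, Q, hQ, hQ1, hQC⟩ := exists_fano_code ℱ (η := δ / 8) (by positivity)
      set ε : ℝ := δ / (2 * (1 + 2 * C)) with hε
      have hε0 : 0 < ε := by positivity
      have hεC : ε * (1 + 2 * C) = δ / 2 := by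
        rw [hε]
        field_simp
      obtain ⟨N, hN⟩ := hπ ε hε0
      obtain ⟨h1, h2⟩ := hN (N + 1) (Nat.le_succ N)
      obtain ⟨ι, r, a, b, hr, hrs, ha, hb, haε, hbε⟩ := exists_decomposition_of_protocol
        N.succ_pos (π (N + 1)) pXY f g hC hQ hQ1 hQC h1 h2
      exact ⟨ι, r, a, b, hr, hrs, ha, hb, by linarith, by linarith⟩
  exact perfectlySecurelyComputable_of_decomposition pXY f g hr hrs hF hG

end Converse

end SecureComputation

end

theorem theorem2 {𝒳 𝒴 ℱ 𝒢 : Type*} [Fintype 𝒳] [Fintype 𝒴] [Fintype ℱ] [Fintype 𝒢]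
    (pXY : PMF (𝒳 × 𝒴)) (f : 𝒳 → 𝒴 → ℱ) (g : 𝒳 → 𝒴 → 𝒢) :
    SecureComputation.AsymptoticallySecurelyComputable pXY f g ↔
      SecureComputation.PerfectlySecurelyComputable pXY f g :=
  ⟨SecureComputation.perfectlySecurelyComputable_of_asymptotically,
    SecureComputation.asymptoticallySecurelyComputable_of_perfectly⟩
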